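/- **Setting.** A $P$-operator on a probability space $(\Omega,\nu)$ is a bounded linear operator $A\colon L^\infty(\Omega,\nu)\to L^1(\Omega,\nu)$ (real-valued functions). For $k\ge 1$ its $k$-profile $\mathcal S_k(A)$ is the set of joint laws on Euclidean $\mathbb R^{2k}$ of $(f_1,\dots,f_k,Af_1,\dots,Af_k)$, where $f_1,\dots,f_k$ range over the closed unit ball of $L^\infty$. The action distance of two $P$-operators (possibly on different spaces) is $d_M(A,B)=\sum_{k\ge1}2^{-k}d_H(\mathcal S_k(A),\mathcal S_k(B))$, where $d_H$ is the Hausdorff distance for the Lévy–Prokhorov metric. $B$ is an action limit of $(A_n)$ if $d_M(A_n,B)\to0$; $A,B$ are weakly equivalent if $d_M(A,B)=0$. $A$ is self-adjoint if $\int (Af)g\,d\nu=\int (Ag)f\,d\nu$ for all $f,g\in L^\infty$; positivity-preserving if $f\ge0$ a.e. implies $Af\ge0$ a.e.; and $c$-regular if $A\mathbb 1=c\mathbb 1$. A finite nonempty simple graph $G$ is identified with its adjacency operator $(Gf)(x)=\sum_{y\sim x}f(y)$ on $V(G)$ with the uniform probability measure, and $G^+$ is $G$ with one new vertex joined to all vertices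 of $G$. A $\nu$-filter is a nonempty collection of measurable sets of positive measure that is closed under intersection of two members and under measurable supersets; a $\nu$-ultrafilter is a maximal $\nu$-filter. For a $\nu$-ultrafilter $\mathcal U$, $\phi_{\mathcal U}\colon L^\infty\to\mathbb R$ is the bounded linear functional sending an $L^\infty$-limit $\lim_n\sum_i\alpha_{n,i}\chi_{E_{n,i}}$ of simple functions to $\lim_n\sum_i\alpha_{n,i}\mathbf 1_{E_{n,i}\in\mathcal U}$. **Theorem.** (1) Let $(G_n)$ be finite nonempty simple graphs with $|V(G_n)|\to\infty$ whose adjacency operators action converge to a $P$-operator $A$ on a separable probability space $(\Omega,\nu)$. Then there is a $\nu$-filter $\mathcal F$ on $\Omega$ such that, for every $\nu$-ultrafilter $\mathcal U\supseteq\mathcal F$, both operators $$A^{+}g=Ag+\phi_{\mathcal U}(g)\mathbb 1,\qquad A^{-}g=Ag-\phi_{\mathcal U}(g)\mathbb 1$$ are action limits of $(G_n^+)$. Moreover, $A^+\ne A^-$ although $A^+$ and $A^-$ are weakly equivalent; neither $A^+$ nor $A^-$ is self-adjoint; and if $A$ is $c$-regular, then $A^+$ is $(c+1)$-regular and $A^-$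 is $(c-1)$-regular. In addition, no $P$-operator on any probability space that is an action limit of $(G_n^+)$ is self-adjoint. (2) The edgeless graphs $E_n$ on $n$ vertices, $n\ge1$, action converge to the zero operator $A=0$ on $[0,1]$ with Lebesgue measure $\lambda$, and there is a $\lambda$-ultrafilter $\mathcal U$ for which $A^{+}=\phi_{\mathcal U}(\cdot)\mathbb 1$ and $A^{-}=-\phi_{\mathcal U}(\cdot)\mathbb 1$ are weakly equivalent action limits of the stars $(E_n^+)$, where $A^+$ is positivity-preserving and $1$-regular while $A^-$ is neither. Thus action limits of graph sequences need not be positivity-preserving, and neither being positivity-preserving nor $c$-regularity is invariant under weak equivalence. -/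

import Mathlib

open MeasureTheory Filter Topology
open scoped ENNReal

noncomputable section

/-! ### `P`-operators -/

/-- A `P`-operator on the (probability) space `(Ω, μ)`: a linear operator from (real) `L^∞` to `L^1`
that is bounded, i.e. whose norm `‖A‖_{∞→1}` is finite. -/
abbrev POperator {Ω : Type*} {m : MeasurableSpace Ω} (μ : Measure Ω) : Type _ :=
  Lp ℝ ∞ μ →L[ℝ] Lp ℝ 1 μ

/-- The bilinear form `(f, g)_A = ∫ (A f) g` is symmetric. -/
def IsSelfAdjointOp {Ω : Type*} {m : MeasurableSpace Ω} {μ : Measure Ω} (A : POperator μ) : Prop :=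
  ∀ f g : Lp ℝ ∞ μ, ∫ ω, A f ω * g ω ∂μ = ∫ ω, A g ω * f ω ∂μ

/-- `A f ≥ 0` almost everywhere whenever `f ≥ 0` almost everywhere. -/
def IsPositivityPreserving {Ω : Type*} {m : MeasurableSpace Ω} {μ : Measure Ω}
    (A : POperator μ) : Prop :=
  ∀ f : Lp ℝ ∞ μ, (∀ᵐ ω ∂μ, 0 ≤ f ω) → ∀ᵐ ω ∂μ, 0 ≤ A f ω

/-- `A` maps the constant function `1` to the constant function `c`. -/
def IsRegularOp {Ω : Type*} {m : MeasurableSpace Ω} {μ : Measure Ω} [IsProbabilityMeasure μ]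
    (c : ℝ) (A : POperator μ) : Prop :=
  A (Lp.const ∞ μ (1 : ℝ)) = c • Lp.const 1 μ (1 : ℝ)

/-! ### Profiles and the action distance -/

/-- The map `ω ↦ (f₁(ω), …, f_k(ω), (A f₁)(ω), …, (A f_k)(ω))` into Euclidean space `ℝ^{2k}`, whose
coordinates are indexed by two copies of `Fin k`. -/
def jointMap {Ω : Type*} {m : MeasurableSpace Ω} {μ : Measure Ω} (A : POperator μ) {k : ℕ}
    (f : Fin k → Lp ℝ ∞ μ) (ω : Ω) : EuclideanSpace ℝ (Fin k ⊕ Fin k) :=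
  WithLp.toLp 2 (Sum.elim (fun i => f i ω) (fun i => A (f i) ω))

theorem measurable_jointMap {Ω : Type*} {m : MeasurableSpace Ω} {μ : Measure Ω} (A : POperator μ)
    {k : ℕ} (f : Fin k → Lp ℝ ∞ μ) : Measurable (jointMap A f) := by
  refine (WithLp.measurable_toLp 2 _).comp (measurable_pi_lambda _ ?_)
  rintro (i | i)
  · exact (Lp.stronglyMeasurable (f i)).measurable
  · exact (Lp.stronglyMeasurable (A (f i))).measurable

/-- The joint distribution `𝒟(f₁, …, f_k, A f₁, …, A f_k)`. -/
def jointLaw {Ω : Type*} {m : MeasurableSpace Ω} {μ : Measure Ω} [IsProbabilityMeasure μ]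
    (A : POperator μ) {k : ℕ} (f : Fin k → Lp ℝ ∞ μ) :
    ProbabilityMeasure (EuclideanSpace ℝ (Fin k ⊕ Fin k)) :=
  ProbabilityMeasure.map ⟨μ, inferInstance⟩ (measurable_jointMap A f).aemeasurable

/-- The `k`-profile of `A`, as a subset of the space of Borel probability measures on `ℝ^{2k}` with
the Lévy-Prokhorov metric. -/
def kProfile {Ω : Type*} {m : MeasurableSpace Ω} {μ : Measure Ω} [IsProbabilityMeasure μ]
    (A : POperator μ) (k : ℕ) :
    Set (LevyProkhorov (ProbabilityMeasure (EuclideanSpace ℝ (Fin k ⊕ Fin k)))) :=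
  {P | ∃ f : Fin k → Lp ℝ ∞ μ, (∀ i, ‖f i‖ ≤ 1) ∧ P = LevyProkhorov.ofMeasure (jointLaw A f)}

/-- The action distance `d_M(A, B) = ∑_{k ≥ 1} 2^{-k} d_H(𝒮_k(A), 𝒮_k(B))`, with values in
`[0, ∞]` (the Lévy-Prokhorov distance is at most `1`, so the values are in fact at most `1`). -/
def actionDist {Ω Ω' : Type*} {m : MeasurableSpace Ω} {m' : MeasurableSpace Ω'}
    {μ : Measure Ω} {μ' : Measure Ω'} [IsProbabilityMeasure μ] [IsProbabilityMeasure μ']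
    (A : POperator μ) (B : POperator μ') : ℝ≥0∞ :=
  ∑' j : ℕ, Metric.hausdorffEDist (kProfile A (j + 1)) (kProfile B (j + 1)) / 2 ^ (j + 1)

/-- Weak equivalence: action distance zero. -/
def WeaklyEquivalent {Ω Ω' : Type*} {m : MeasurableSpace Ω} {m' : MeasurableSpace Ω'}
    {μ : Measure Ω} {μ' : Measure Ω'} [IsProbabilityMeasure μ] [IsProbabilityMeasure μ']
    (A : POperator μ) (B : POperator μ') : Prop :=
  actionDist A B = 0

/-- The sequence `A` of `P`-operators action converges to `B`, i.e. `B` is an action limit of it. -/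
def ActionConverges {Ω : ℕ → Type*} {m : ∀ n, MeasurableSpace (Ω n)} {μ : ∀ n, Measure (Ω n)}
    [∀ n, IsProbabilityMeasure (μ n)] (A : ∀ n, POperator (μ n))
    {Ω' : Type*} {m' : MeasurableSpace Ω'} {μ' : Measure Ω'} [IsProbabilityMeasure μ']
    (B : POperator μ') : Prop :=
  Tendsto (fun n => actionDist (A n) B) atTop (𝓝 0)

/-! ### Graphs as `P`-operators -/

/-- The uniform distribution on a finite nonempty set, on the `σ`-algebra of all subsets. -/
def uniformMeasure (V : Type*) [Fintype V] [Nonempty V] : @Measure V ⊤ :=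
  letI : MeasurableSpace V := ⊤
  (PMF.uniformOfFintype V).toMeasure

instance uniformMeasure.isProbabilityMeasure (V : Type*) [Fintype V] [Nonempty V] :
    IsProbabilityMeasure (uniformMeasure V) :=
  letI : MeasurableSpace V := ⊤
  PMF.toMeasure.isProbabilityMeasure _

theorem forall_of_ae_uniformMeasure {V : Type*} [Fintype V] [Nonempty V] {p : V → Prop}
    (h : ∀ᵐ x ∂(uniformMeasure V), p x) (x : V) : p x := by
  let _ : MeasurableSpace V := ⊤
  by_contra hx
  have h0 : uniformMeasure V {x} = 0 := measure_mono_null (by simpa using hx) h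
  have h1 : uniformMeasure V {x} = PMF.uniformOfFintype V x :=
    PMF.toMeasure_apply_singleton _ x trivial
  rw [h1, PMF.uniformOfFintype_apply] at h0
  simp at h0

open Classical in
/-- The adjacency matrix of `G` acting on functions: `(G f)(x) = ∑_{y ∼ x} f(y)`. -/
def adjacencyFun {V : Type*} [Fintype V] (G : SimpleGraph V) (f : V → ℝ) (x : V) : ℝ :=
  ∑ y, if G.Adj x y then f y else 0

theorem memLp_uniformMeasure {V : Type*} [Fintype V] [Nonempty V] (f : V → ℝ) (p : ℝ≥0∞) :
    MemLp f p (uniformMeasure V) := by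
  let _ : MeasurableSpace V := ⊤
  refine MemLp.of_bound (measurable_from_top.aestronglyMeasurable) (∑ x, ‖f x‖)
    (Eventually.of_forall fun x => ?_)
  exact Finset.single_le_sum (f := fun x => ‖f x‖) (fun _ _ => norm_nonneg _) (Finset.mem_univ x)

/-- The adjacency operator of a finite graph, as a `P`-operator on the uniform probability space of
its vertices. -/
def adjacencyOperator {V : Type*} [Fintype V] [Nonempty V] (G : SimpleGraph V) :
    POperator (uniformMeasure V) :=
  LinearMap.mkContinuous
    { toFun := fun f => (memLp_uniformMeasure (adjacencyFun G f) 1).toLp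
      map_add' := fun f g => by
        rw [← MemLp.toLp_add]
        refine MemLp.toLp_congr _ _ (Eventually.of_forall fun x => ?_)
        simp only [adjacencyFun, Pi.add_apply, ← Finset.sum_add_distrib]
        refine Finset.sum_congr rfl fun y _ => ?_
        rw [forall_of_ae_uniformMeasure (Lp.coeFn_add f g) y]
        split_ifs <;> simp
      map_smul' := fun c f => by
        rw [RingHom.id_apply, ← MemLp.toLp_const_smul]
        refine MemLp.toLp_congr _ _ (Eventually.of_forall fun x => ?_)
        simp only [adjacencyFun, Pi.smul_apply, Finset.smul_sum]
        refine Finset.sum_congr rfl fun y _ => ?_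
        rw [forall_of_ae_uniformMeasure (Lp.coeFn_smul c f) y]
        split_ifs <;> simp }
    (Fintype.card V) (fun f => by
      have hf : ∀ y, ‖f y‖ ≤ ‖f‖ := by
        refine forall_of_ae_uniformMeasure ?_
        filter_upwards [ae_le_eLpNormEssSup (f := f) (μ := uniformMeasure V)] with y hy
        rw [Lp.norm_def, eLpNorm_exponent_top, ← toReal_enorm]
        refine ENNReal.toReal_mono ?_ hy
        rw [← eLpNorm_exponent_top]
        exact Lp.eLpNorm_ne_top f
      have key := Lp.norm_le_of_ae_bound (μ := uniformMeasure V) (p := 1)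
        (f := (memLp_uniformMeasure (adjacencyFun G f) 1).toLp)
        (C := Fintype.card V * ‖f‖) (by positivity) (by
          filter_upwards [(memLp_uniformMeasure (adjacencyFun G f) 1).coeFn_toLp] with x hx
          rw [hx]
          refine (norm_sum_le _ _).trans ?_
          refine (Finset.sum_le_card_nsmul _ _ ‖f‖ fun y _ => ?_).trans_eq ?_
          · split_ifs
            · exact hf y
            · simp
          · simp [Finset.card_univ])
      simpa [measureUnivNNReal] using key)

/-- The graph `G⁺`: one new vertex (`none`) is added to `G` and joined to all vertices of `G`. -/
def SimpleGraph.addUniversalVertex {V : Type*} (G : SimpleGraph V) : SimpleGraph (Option V) where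
  Adj
    | none, none => False
    | none, some _ => True
    | some _, none => True
    | some x, some y => G.Adj x y
  symm := ⟨by
    rintro (_ | x) (_ | y) h
    · exact h
    · trivial
    · trivial
    · exact SimpleGraph.Adj.symm (G := G) h⟩
  loopless := ⟨by
    rintro (_ | x) h
    · exact h
    · exact G.irrefl h⟩

/-! ### `ν`-filters, `ν`-ultrafilters and the functional `φ_𝒰` -/

/-- A `ν`-filter: a nonempty collection of measurable sets of positive measure, closed under
intersections and measurable supersets. A `ν`-ultrafilter is a maximal `ν`-filter, i.e. a collection
`U` with `Maximal (IsMeasureFilter ν) U`. -/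
structure IsMeasureFilter {Ω : Type*} {m : MeasurableSpace Ω} (ν : Measure Ω)
    (F : Set (Set Ω)) : Prop where
  nonempty : F.Nonempty
  measurableSet : ∀ S ∈ F, MeasurableSet S
  pos : ∀ S ∈ F, 0 < ν S
  inter : ∀ S ∈ F, ∀ T ∈ F, S ∩ T ∈ F
  superset : ∀ S ∈ F, ∀ T, MeasurableSet T → S ⊆ T → T ∈ F

open Classical in
/-- `φ` sends `lim_n ∑_i α_{n,i} χ_{E_{n,i}}` (a limit in `L^∞` of simple functions) to
`lim_n ∑_i α_{n,i} 𝟙_{E_{n,i} ∈ U}`. -/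
def IsFilterFunctional {Ω : Type*} {m : MeasurableSpace Ω} {ν : Measure Ω} (U : Set (Set Ω))
    (φ : Lp ℝ ∞ ν →L[ℝ] ℝ) : Prop :=
  ∀ (f : Lp ℝ ∞ ν) (N : ℕ → ℕ) (α : ∀ n, Fin (N n) → ℝ) (E : ∀ n, Fin (N n) → Set Ω),
    (∀ n i, MeasurableSet (E n i)) →
    Tendsto (fun n => eLpNorm
      (fun ω => f ω - ∑ i, α n i * (E n i).indicator (fun _ => (1 : ℝ)) ω) ∞ ν) atTop (𝓝 0) →
    Tendsto (fun n => ∑ i, α n i * (if E n i ∈ U then 1 else 0)) atTop (𝓝 (φ f))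

namespace IsMeasureFilter

variable {Ω : Type*} {m : MeasurableSpace Ω} {ν : Measure Ω} {U : Set (Set Ω)}

theorem mem_of_forall_pos (hU : Maximal (IsMeasureFilter ν) U) {E : Set Ω} (hE : MeasurableSet E)
    (h : ∀ S ∈ U, 0 < ν (S ∩ E)) : E ∈ U := by
  have hF : IsMeasureFilter ν {T | MeasurableSet T ∧ ∃ S ∈ U, S ∩ E ⊆ T} := by
    refine ⟨?_, fun S hS => hS.1, ?_, ?_, ?_⟩
    · obtain ⟨S, hS⟩ := hU.prop.nonempty
      exact ⟨E, hE, S, hS, Set.inter_subset_right⟩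
    · rintro T ⟨-, S, hS, hST⟩
      exact (h S hS).trans_le (measure_mono hST)
    · rintro T ⟨hT, S, hS, hST⟩ T' ⟨hT', S', hS', hST'⟩
      refine ⟨hT.inter hT', S ∩ S', hU.prop.inter S hS S' hS', fun x hx => ?_⟩
      exact ⟨hST ⟨hx.1.1, hx.2⟩, hST' ⟨hx.1.2, hx.2⟩⟩
    · rintro T ⟨-, S, hS, hST⟩ T' hT' hTT'
      exact ⟨hT', S, hS, hST.trans hTT'⟩
  refine hU.le_of_ge hF (fun S hS => ⟨hU.prop.measurableSet S hS, S, hS, ?_⟩) ⟨hE, ?_⟩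
  · exact Set.inter_subset_left
  · obtain ⟨S, hS⟩ := hU.prop.nonempty
    exact ⟨S, hS, Set.inter_subset_right⟩

theorem mem_or_compl_mem (hU : Maximal (IsMeasureFilter ν) U) {E : Set Ω}
    (hE : MeasurableSet E) : E ∈ U ∨ Eᶜ ∈ U := by
  by_contra! hcon
  have h1 : ∃ S ∈ U, ν (S ∩ E) = 0 := by
    by_contra! h
    exact hcon.1 (mem_of_forall_pos hU hE fun S hS => pos_iff_ne_zero.2 (h S hS))
  have h2 : ∃ S ∈ U, ν (S ∩ Eᶜ) = 0 := by
    by_contra! h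
    exact hcon.2 (mem_of_forall_pos hU hE.compl fun S hS => pos_iff_ne_zero.2 (h S hS))
  obtain ⟨S, hS, hS0⟩ := h1
  obtain ⟨T, hT, hT0⟩ := h2
  refine (hU.prop.pos _ (hU.prop.inter S hS T hT)).ne' (measure_mono_null ?_
    (measure_union_null hS0 hT0))
  intro x hx
  by_cases hxE : x ∈ E
  · exact Or.inl ⟨hx.1, hxE⟩
  · exact Or.inr ⟨hx.2, hxE⟩

theorem mem_of_ae (hU : Maximal (IsMeasureFilter ν) U) {E : Set Ω} (hE : MeasurableSet E)
    (h : ∀ᵐ ω ∂ν, ω ∈ E) : E ∈ U :=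
  (mem_or_compl_mem hU hE).resolve_right fun h' => (hU.prop.pos _ h').ne' h

theorem nonempty_of_mem (hU : Maximal (IsMeasureFilter ν) U) {E : Set Ω} (hE : E ∈ U) :
    E.Nonempty :=
  nonempty_of_measure_ne_zero (hU.prop.pos E hE).ne'

theorem univ_mem (hU : Maximal (IsMeasureFilter ν) U) : Set.univ ∈ U :=
  mem_of_ae hU MeasurableSet.univ (by simp)

theorem ae_abs_le_norm (f : Lp ℝ ∞ ν) : ∀ᵐ ω ∂ν, |f ω| ≤ ‖f‖ := by
  filter_upwards [ae_le_eLpNormEssSup (f := f) (μ := ν)] with y hy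
  rw [Lp.norm_def, eLpNorm_exponent_top, ← Real.norm_eq_abs, ← toReal_enorm]
  refine ENNReal.toReal_mono ?_ hy
  rw [← eLpNorm_exponent_top]
  exact Lp.eLpNorm_ne_top f

theorem measurable_coe (f : Lp ℝ ∞ ν) : Measurable f := (Lp.stronglyMeasurable f).measurable

/-- Along a `ν`-ultrafilter, every `f ∈ L^∞` has a limit. -/
theorem exists_value (hU : Maximal (IsMeasureFilter ν) U) (f : Lp ℝ ∞ ν) :
    ∃ c : ℝ, ∀ ε > 0, {ω | |f ω - c| < ε} ∈ U := by
  have hf := measurable_coe f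
  set T : Set ℝ := {a | {ω | a ≤ f ω} ∈ U} with hT
  have hne : T.Nonempty := by
    refine ⟨-‖f‖, mem_of_ae hU (measurableSet_le measurable_const hf) ?_⟩
    filter_upwards [ae_abs_le_norm f] with ω hω
    exact (abs_le.1 hω).1
  have hbd : BddAbove T := by
    refine ⟨‖f‖, fun a ha => ?_⟩
    have h2 : {ω | f ω ≤ ‖f‖} ∈ U := by
      refine mem_of_ae hU (measurableSet_le hf measurable_const) ?_
      filter_upwards [ae_abs_le_norm f] with ω hω
      exact (abs_le.1 hω).2
    obtain ⟨ω, h3, h4⟩ := nonempty_of_mem hU (hU.prop.inter _ ha _ h2)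
    exact le_trans h3 h4
  refine ⟨sSup T, fun ε hε => ?_⟩
  obtain ⟨a, haT, ha⟩ := exists_lt_of_lt_csSup hne (sub_lt_self (sSup T) hε)
  have h2 : {ω | sSup T + ε ≤ f ω}ᶜ ∈ U := by
    refine (mem_or_compl_mem hU (measurableSet_le measurable_const hf)).resolve_left fun h => ?_
    have := le_csSup hbd (show sSup T + ε ∈ T from h)
    linarith
  refine hU.prop.superset _ (hU.prop.inter _ haT _ h2) _
    (measurableSet_lt (by fun_prop) measurable_const) ?_
  rintro ω ⟨h3, h4⟩
  simp only [Set.mem_ofPred_eq, Set.mem_compl_iff, not_le] at h3 h4 ⊢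
  rw [abs_lt]
  constructor <;> linarith

theorem exists_functional (hU : Maximal (IsMeasureFilter ν) U) :
    ∃ φ : Lp ℝ ∞ ν →L[ℝ] ℝ, ∀ f, ∀ ε > 0, {ω | |f ω - φ f| < ε} ∈ U := by
  choose c hc using exists_value hU
  refine ⟨LinearMap.mkContinuous { toFun := c, map_add' := ?_, map_smul' := ?_ } 1 ?_, hc⟩
  · intro f g
    refine eq_of_forall_dist_le fun ε hε => ?_
    have h0 : {ω | (f + g : Lp ℝ ∞ ν) ω = f ω + g ω} ∈ U :=
      mem_of_ae hU (measurableSet_eq_fun (measurable_coe _)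
        ((measurable_coe f).add (measurable_coe g))) (Lp.coeFn_add f g)
    obtain ⟨ω, ⟨h1, h2⟩, h3, h4⟩ := nonempty_of_mem hU (hU.prop.inter _
      (hU.prop.inter _ h0 _ (hc (f + g) (ε / 3) (by positivity))) _
      (hU.prop.inter _ (hc f (ε / 3) (by positivity)) _ (hc g (ε / 3) (by positivity))))
    simp only [Set.mem_ofPred_eq] at h1 h2 h3 h4
    rw [h1] at h2
    rw [abs_lt] at h2 h3 h4
    rw [Real.dist_eq, abs_le]
    constructor <;> linarith
  · intro a f
    refine eq_of_forall_dist_le fun ε hε => ?_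
    have h0 : {ω | (a • f : Lp ℝ ∞ ν) ω = a * f ω} ∈ U :=
      mem_of_ae hU (measurableSet_eq_fun (measurable_coe _)
        ((measurable_coe f).const_mul a)) (Lp.coeFn_smul a f)
    obtain ⟨ω, ⟨h1, h2⟩, h3⟩ := nonempty_of_mem hU (hU.prop.inter _
      (hU.prop.inter _ h0 _ (hc (a • f) (ε / 2) (by positivity))) _
      (hc f (ε / (2 * (|a| + 1))) (by positivity)))
    simp only [Set.mem_ofPred_eq] at h1 h2 h3
    rw [h1] at h2
    have h5 : |a * f ω - a * c f| ≤ ε / 2 := by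
      rw [← mul_sub, abs_mul]
      calc |a| * |f ω - c f| ≤ (|a| + 1) * (ε / (2 * (|a| + 1))) := by
            gcongr
            linarith
        _ = ε / 2 := by field_simp
    rw [abs_lt] at h2
    rw [abs_le] at h5
    rw [Real.dist_eq, abs_le, RingHom.id_apply, smul_eq_mul]
    constructor <;> linarith
  · intro f
    change |c f| ≤ 1 * ‖f‖
    rw [one_mul]
    refine le_of_forall_pos_le_add fun ε hε => ?_
    have h0 : {ω | |f ω| ≤ ‖f‖} ∈ U :=
      mem_of_ae hU (measurableSet_le (measurable_coe f).norm measurable_const)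
        (ae_abs_le_norm f)
    obtain ⟨ω, h1, h2⟩ := nonempty_of_mem hU (hU.prop.inter _ h0 _ (hc f ε hε))
    simp only [Set.mem_ofPred_eq] at h1 h2
    rw [abs_lt] at h2
    rw [abs_le] at h1 ⊢
    constructor <;> linarith

open Classical in
theorem simple_mem (hU : Maximal (IsMeasureFilter ν) U) {N : ℕ} (α : Fin N → ℝ)
    (E : Fin N → Set Ω) (hE : ∀ i, MeasurableSet (E i)) :
    ∃ S ∈ U, ∀ ω ∈ S, ∑ i, α i * (E i).indicator (fun _ => (1 : ℝ)) ω =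
      ∑ i, α i * (if E i ∈ U then 1 else 0) := by
  have key : ∀ s : Finset (Fin N), ∃ S ∈ U, ∀ ω ∈ S, ∀ i ∈ s,
      (E i).indicator (fun _ => (1 : ℝ)) ω = if E i ∈ U then 1 else 0 := by
    intro s
    induction s using Finset.induction_on with
    | empty => exact ⟨Set.univ, univ_mem hU, by simp⟩
    | insert i s _ ih =>
      obtain ⟨S, hS, h⟩ := ih
      by_cases hi : E i ∈ U
      · refine ⟨S ∩ E i, hU.prop.inter _ hS _ hi, fun ω hω j hj => ?_⟩
        rcases Finset.mem_insert.1 hj with rfl | hj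
        · simp [hi, hω.2]
        · exact h ω hω.1 j hj
      · have hi' := (mem_or_compl_mem hU (hE i)).resolve_left hi
        refine ⟨S ∩ (E i)ᶜ, hU.prop.inter _ hS _ hi', fun ω hω j hj => ?_⟩
        rcases Finset.mem_insert.1 hj with rfl | hj
        · have := hω.2
          rw [Set.mem_compl_iff] at this
          simp [hi, this]
        · exact h ω hω.1 j hj
  obtain ⟨S, hS, h⟩ := key Finset.univ
  exact ⟨S, hS, fun ω hω => Finset.sum_congr rfl fun i hi => by rw [h ω hω i hi]⟩

/-- Every `f ∈ L^∞` is a limit in `L^∞` of simple functions. -/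
theorem exists_simple_approx (f : Lp ℝ ∞ ν) :
    ∃ (N : ℕ → ℕ) (α : ∀ n, Fin (N n) → ℝ) (E : ∀ n, Fin (N n) → Set Ω),
      (∀ n i, MeasurableSet (E n i)) ∧
      Tendsto (fun n => eLpNorm
        (fun ω => f ω - ∑ i, α n i * (E n i).indicator (fun _ => (1 : ℝ)) ω) ∞ ν)
        atTop (𝓝 0) := by
  set M : ℕ := ⌈‖f‖⌉₊ with hM
  have hfM : ‖f‖ ≤ M := Nat.le_ceil _
  refine ⟨fun n => 2 * (M * (n + 1)) + 1,
    fun n i => ((i : ℝ) - M * (n + 1)) / (n + 1),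
    fun n i => {ω | ⌊f ω * (n + 1)⌋ = (i : ℤ) - M * (n + 1)}, fun n i => ?_, ?_⟩
  · exact measurableSet_eq_fun (Int.measurable_floor.comp ((measurable_coe f).mul_const _))
      measurable_const
  · have hlim : Tendsto (fun n : ℕ => ENNReal.ofReal (1 / ((n : ℝ) + 1))) atTop (𝓝 0) := by
      simpa using ENNReal.tendsto_ofReal (tendsto_one_div_add_atTop_nhds_zero_nat (𝕜 := ℝ))
    refine tendsto_of_tendsto_of_tendsto_of_le_of_le tendsto_const_nhds hlim
      (fun _ => bot_le) fun n => ?_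
    rw [eLpNorm_exponent_top]
    refine eLpNormEssSup_le_of_ae_bound ?_
    filter_upwards [ae_abs_le_norm f] with ω hω
    have hn : (0 : ℝ) < n + 1 := by positivity
    obtain ⟨h1, h2⟩ := abs_le.1 (hω.trans hfM)
    have hlo : -((M : ℤ) * (n + 1)) ≤ ⌊f ω * (n + 1)⌋ := by
      rw [Int.le_floor]
      push_cast
      nlinarith
    have hhi : ⌊f ω * (n + 1)⌋ ≤ (M : ℤ) * (n + 1) := by
      have : ((⌊f ω * (n + 1)⌋ : ℤ) : ℝ) ≤ ((M : ℤ) * (n + 1) : ℤ) := by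
        refine (Int.floor_le _).trans ?_
        push_cast
        nlinarith
      exact_mod_cast this
    obtain ⟨j, hj⟩ := Int.eq_ofNat_of_zero_le (show 0 ≤ ⌊f ω * (n + 1)⌋ + M * (n + 1) by linarith)
    have hjlt : j < 2 * (M * (n + 1)) + 1 := by
      zify
      linarith
    have hjr : (j : ℝ) = ⌊f ω * (n + 1)⌋ + M * (n + 1) := by
      exact_mod_cast hj.symm
    rw [Finset.sum_eq_single (⟨j, hjlt⟩ : Fin _)]
    · rw [Set.indicator_of_mem (by simp only [Set.mem_ofPred_eq]; linarith)]
      have hfl := Int.floor_le (f ω * ((n : ℝ) + 1))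
      have hfl' := Int.lt_floor_add_one (f ω * ((n : ℝ) + 1))
      simp only [hjr, mul_one, add_sub_cancel_right]
      rw [Real.norm_eq_abs, abs_le]
      constructor
      · rw [← sub_nonneg]
        have : f ω - (⌊f ω * ((n : ℝ) + 1)⌋ : ℝ) / (n + 1) - -(1 / (n + 1)) =
            (f ω * (n + 1) + 1 - ⌊f ω * ((n : ℝ) + 1)⌋) / (n + 1) := by
          field_simp
          ring
        rw [this]
        apply div_nonneg _ hn.le
        linarith
      · rw [← sub_nonneg]
        have : 1 / ((n : ℝ) + 1) - (f ω - (⌊f ω * ((n : ℝ) + 1)⌋ : ℝ) / (n + 1)) =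
            (⌊f ω * ((n : ℝ) + 1)⌋ + 1 - f ω * (n + 1)) / (n + 1) := by
          field_simp
          ring
        rw [this]
        apply div_nonneg _ hn.le
        linarith
    · intro i _ hij
      rw [Set.indicator_of_notMem, mul_zero]
      intro hi
      simp only [Set.mem_ofPred_eq] at hi
      apply hij
      ext
      have : (i : ℤ) = j := by linarith
      exact_mod_cast this
    · intro h
      exact absurd (Finset.mem_univ _) h

theorem isFilterFunctional_of_forall (hU : Maximal (IsMeasureFilter ν) U)
    {φ : Lp ℝ ∞ ν →L[ℝ] ℝ} (hφ : ∀ f, ∀ ε > 0, {ω | |f ω - φ f| < ε} ∈ U) :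
    IsFilterFunctional U φ := by
  intro f N α E hE hlim
  rw [Metric.tendsto_atTop]
  intro ε hε
  obtain ⟨n₀, hn₀⟩ := eventually_atTop.1 (hlim.eventually_lt_const
    (ENNReal.ofReal_pos.2 (half_pos hε)))
  refine ⟨n₀, fun n hn => ?_⟩
  obtain ⟨S, hS, hSeq⟩ := simple_mem hU (α n) (E n) (hE n)
  have h1 : {ω | |f ω - ∑ i, α n i * (E n i).indicator (fun _ => (1 : ℝ)) ω| < ε / 2} ∈ U := by
    refine mem_of_ae hU ?_ ?_
    · refine measurableSet_lt (Measurable.norm ((measurable_coe f).sub ?_)) measurable_const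
      refine Finset.measurable_sum _ fun i _ => ?_
      exact (measurable_const.indicator (hE n i)).const_mul _
    · filter_upwards [ae_le_eLpNormEssSup (μ := ν)
        (f := fun ω => f ω - ∑ i, α n i * (E n i).indicator (fun _ => (1 : ℝ)) ω)] with ω hω
      have := hω.trans_lt (by simpa [eLpNorm_exponent_top] using hn₀ n hn)
      rwa [← ofReal_norm, ENNReal.ofReal_lt_ofReal_iff (half_pos hε)] at this
  obtain ⟨ω, ⟨h2, h3⟩, h4⟩ := nonempty_of_mem hU (hU.prop.inter _
    (hU.prop.inter _ h1 _ (hφ f (ε / 2) (half_pos hε))) _ hS)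
  simp only [Set.mem_ofPred_eq] at h2 h3
  rw [hSeq ω h4] at h2
  rw [abs_lt] at h2 h3
  rw [Real.dist_eq, abs_lt]
  constructor <;> linarith

theorem existsUnique_functional (hU : Maximal (IsMeasureFilter ν) U) :
    ∃! φ : Lp ℝ ∞ ν →L[ℝ] ℝ, IsFilterFunctional U φ := by
  obtain ⟨φ, hφ⟩ := exists_functional hU
  refine ⟨φ, isFilterFunctional_of_forall hU hφ, fun ψ hψ => ?_⟩
  ext f
  obtain ⟨N, α, E, hE, hlim⟩ := exists_simple_approx f
  exact tendsto_nhds_unique (hψ f N α E hE hlim)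
    (isFilterFunctional_of_forall hU hφ f N α E hE hlim)

end IsMeasureFilter

/-- The functional `φ_U : L^∞ → ℝ` of a `ν`-ultrafilter `U`. -/
def ultrafilterFunctional {Ω : Type*} {m : MeasurableSpace Ω} {ν : Measure Ω} {U : Set (Set Ω)}
    (hU : Maximal (IsMeasureFilter ν) U) : Lp ℝ ∞ ν →L[ℝ] ℝ :=
  (IsMeasureFilter.existsUnique_functional hU).choose

/-- `φ_U` is the (unique) functional that it should be. -/
theorem ultrafilterFunctional_spec {Ω : Type*} {m : MeasurableSpace Ω} {ν : Measure Ω}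
    {U : Set (Set Ω)} (hU : Maximal (IsMeasureFilter ν) U) :
    IsFilterFunctional U (ultrafilterFunctional hU) :=
  (IsMeasureFilter.existsUnique_functional hU).choose_spec.1

/-- The operator `g ↦ A g + φ_U(g) 𝟙`. -/
def plusOperator {Ω : Type*} {m : MeasurableSpace Ω} {ν : Measure Ω} [IsProbabilityMeasure ν]
    (A : POperator ν) {U : Set (Set Ω)} (hU : Maximal (IsMeasureFilter ν) U) : POperator ν :=
  A + (ultrafilterFunctional hU).smulRight (Lp.const 1 ν (1 : ℝ))

/-- The operator `g ↦ A g - φ_U(g) 𝟙`. -/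
def minusOperator {Ω : Type*} {m : MeasurableSpace Ω} {ν : Measure Ω} [IsProbabilityMeasure ν]
    (A : POperator ν) {U : Set (Set Ω)} (hU : Maximal (IsMeasureFilter ν) U) : POperator ν :=
  A - (ultrafilterFunctional hU).smulRight (Lp.const 1 ν (1 : ℝ))

end

/-! At an old vertex `x`, the operator of `G⁺` gives `(G F)(x) + F(none)`, and the new vertex
carries mass at most `1/|V|`. So, up to `1/|V|`, the joint laws of `G⁺` are those of `G` with the
image coordinates translated by a vector `c ∈ [-1,1]^k`, and `c` is independent of the functions on
`G`. `A ± φ_U 𝟙` has the same profiles in the limit if `φ_U(g_i)` can be prescribed at will without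
disturbing the joint law of `g` and `A g`. Both signs work because `[-1,1]^k` is symmetric
(`hausdorffEDist_kProfile_addUniversalVertex_le`).

To prescribe `φ_U`, overwrite `g_i` by `c_i` on a set `S ∈ U`. This is harmless if `S` has small
measure and `A` is small on unit-ball functions supported in `S`
(`exists_ultrafilterFunctional_eq_edist_le`). The filter `F` is generated by a decreasing sequence
of such sets. They exist for two reasons. The limit space is atomless, since an injective labelling
of a large graph has spread-out values (`ActionConverges.exists_cover_measure_le`). And, by
Khintchine's inequality, `n` unit-ball functions with disjoint supports have images whose `L¹` norms
sum to at most `4 √n ‖A‖`, so `A` must be small on one of infinitely many disjoint sets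
(`exists_norm_map_le_of_disjoint`).

No limit `B` of `(G_n⁺)` is self-adjoint: the indicators of the new vertices yield `g_j → 0` almost
everywhere with `B g_j` close to `1`. Then `∫ (B g_j) h` stays away from `0` for a suitable
indicator `h`, while `∫ (B h) g_j → 0` by dominated convergence.

For stars, laws on edgeless graphs and on `[0,1]` approximate each other by step functions and
rounding, which gives the limit `A = 0`; evaluating `±φ_U` at `𝟙` gives the rest. -/

theorem norm_le_of_ae_abs_le {Ω : Type*} {m : MeasurableSpace Ω} {μ : Measure Ω}
    [IsProbabilityMeasure μ] (f : Lp ℝ ∞ μ) {C : ℝ} (hC : 0 ≤ C) (h : ∀ᵐ ω ∂μ, |f ω| ≤ C) :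
    ‖f‖ ≤ C := by
  simpa [measureUnivNNReal] using Lp.norm_le_of_ae_bound (p := ∞) hC h

/-! ### Lévy–Prokhorov estimates. -/

/-- Between probability measures one of the two defining inequalities implies the other by passing
to complements, so distance bounds need only one direction. -/
theorem levyProkhorov_edist_le {E : Type*} [MeasurableSpace E] [PseudoMetricSpace E]
    [OpensMeasurableSpace E] {P Q : ProbabilityMeasure E} {δ : ℝ≥0∞}
    (h : ∀ ε B, δ < ε → ε < ∞ → MeasurableSet B →
      (P : Measure E) B ≤ (Q : Measure E) (Metric.thickening ε.toReal B) + ε) :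
    edist (LevyProkhorov.ofMeasure P) (LevyProkhorov.ofMeasure Q) ≤ δ :=
  levyProkhorovEDist_le_of_forall_le (P : Measure E) (Q : Measure E) δ h

theorem levyProkhorov_le_of_edist_lt {E : Type*} [MeasurableSpace E] [PseudoMetricSpace E]
    [OpensMeasurableSpace E] {P Q : ProbabilityMeasure E} {ε : ℝ≥0∞}
    (h : edist (LevyProkhorov.ofMeasure P) (LevyProkhorov.ofMeasure Q) < ε)
    {B : Set E} (hB : MeasurableSet B) :
    (P : Measure E) B ≤ (Q : Measure E) (Metric.thickening ε.toReal B) + ε :=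
  left_measure_le_of_levyProkhorovEDist_lt (μ := (P : Measure E)) (ν := (Q : Measure E)) h hB

theorem levyProkhorov_edist_le_one {E : Type*} [MeasurableSpace E] [PseudoMetricSpace E]
    [OpensMeasurableSpace E] (P Q : LevyProkhorov (ProbabilityMeasure E)) : edist P Q ≤ 1 := by
  refine (levyProkhorovEDist_le_max_measure_univ _ _).trans ?_
  simp

/-- A 1-Lipschitz `T` maps the thickening of `T⁻¹ B` into the thickening of `B` of the same radius.
-/
theorem levyProkhorov_edist_map_le {E : Type*} [MeasurableSpace E] [PseudoMetricSpace E]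
    [OpensMeasurableSpace E] (P Q : ProbabilityMeasure E) {T : E → E} (hT : Measurable T)
    (hlip : ∀ x y, dist (T x) (T y) ≤ dist x y) :
    edist (LevyProkhorov.ofMeasure (P.map hT.aemeasurable))
      (LevyProkhorov.ofMeasure (Q.map hT.aemeasurable)) ≤
      edist (LevyProkhorov.ofMeasure P) (LevyProkhorov.ofMeasure Q) := by
  refine levyProkhorov_edist_le fun ε B hε hε' hB => ?_
  rw [ProbabilityMeasure.toMeasure_map, ProbabilityMeasure.toMeasure_map,
    Measure.map_apply hT hB, Measure.map_apply hT Metric.isOpen_thickening.measurableSet]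
  refine (levyProkhorov_le_of_edist_lt hε (hT hB)).trans ?_
  gcongr
  intro x hx
  obtain ⟨y, hy, hxy⟩ := Metric.mem_thickening_iff.1 hx
  exact Metric.mem_thickening_iff.2 ⟨T y, hy, (hlip x y).trans_lt hxy⟩

/-! ### Joint laws of functions and their images. -/

section jointLaw

variable {Ω : Type*} {m : MeasurableSpace Ω} {μ : Measure Ω} [IsProbabilityMeasure μ]

theorem jointLaw_apply (A : POperator μ) {k : ℕ} (f : Fin k → Lp ℝ ∞ μ)
    {B : Set (EuclideanSpace ℝ (Fin k ⊕ Fin k))} (hB : MeasurableSet B) :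
    (jointLaw A f : Measure _) B = μ (jointMap A f ⁻¹' B) := by
  exact Measure.map_apply (measurable_jointMap A f) hB

theorem jointLaw_mem_kProfile (A : POperator μ) {k : ℕ} {f : Fin k → Lp ℝ ∞ μ}
    (hf : ∀ i, ‖f i‖ ≤ 1) : LevyProkhorov.ofMeasure (jointLaw A f) ∈ kProfile A k :=
  ⟨f, hf, rfl⟩

theorem kProfile_nonempty (A : POperator μ) (k : ℕ) : (kProfile A k).Nonempty :=
  ⟨_, jointLaw_mem_kProfile A (f := fun _ => 0) (by simp)⟩

/-- Convergence in probability controls convergence in law: both maps live on one space, which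
couples the two laws. -/
theorem edist_jointLaw_le_of_measure_dist_le (A A' : POperator μ) {k : ℕ}
    (f g : Fin k → Lp ℝ ∞ μ) {δ : ℝ} (hδ : 0 ≤ δ)
    (h : μ {ω | ¬ dist (jointMap A f ω) (jointMap A' g ω) ≤ δ} ≤ ENNReal.ofReal δ) :
    edist (LevyProkhorov.ofMeasure (jointLaw A f)) (LevyProkhorov.ofMeasure (jointLaw A' g)) ≤
      ENNReal.ofReal δ := by
  refine levyProkhorov_edist_le fun ε B hε hε' hB => ?_
  rw [jointLaw_apply A f hB, jointLaw_apply A' g Metric.isOpen_thickening.measurableSet]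
  refine le_trans ((measure_mono ?_).trans (measure_union_le _ _)) (add_le_add le_rfl
    (h.trans hε.le))
  intro ω hω
  by_cases hd : dist (jointMap A f ω) (jointMap A' g ω) ≤ δ
  · refine Or.inl (Metric.mem_thickening_iff.2 ⟨_, hω, ?_⟩)
    rw [dist_comm]
    refine hd.trans_lt ?_
    rwa [← ENNReal.ofReal_lt_iff_lt_toReal hδ hε'.ne]
  · exact Or.inr hd

theorem dist_euclidean_le {ι : Type*} [Fintype ι] (x y : EuclideanSpace ℝ ι) {r : ℝ} (hr : 0 ≤ r)
    (h : ∀ i, |x i - y i| ≤ r) : dist x y ≤ Fintype.card ι * r := by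
  rw [EuclideanSpace.dist_eq]
  refine Real.sqrt_le_iff.2 ⟨by positivity, ?_⟩
  calc ∑ i, dist (x i) (y i) ^ 2 ≤ ∑ _i : ι, r ^ 2 := by
        refine Finset.sum_le_sum fun i _ => ?_
        rw [Real.dist_eq]
        exact pow_le_pow_left₀ (abs_nonneg _) (h i) 2
    _ = Fintype.card ι * r ^ 2 := by simp
    _ ≤ (Fintype.card ι : ℝ) ^ 2 * r ^ 2 := by
        refine mul_le_mul_of_nonneg_right ?_ (sq_nonneg r)
        exact_mod_cast Nat.le_self_pow two_ne_zero _
    _ = (Fintype.card ι * r) ^ 2 := by ring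

theorem abs_apply_le_dist {ι : Type*} [Fintype ι] (x y : EuclideanSpace ℝ ι) (i : ι) :
    |x i - y i| ≤ dist x y := by
  rw [← Real.dist_eq]
  exact PiLp.dist_apply_le x y i

omit [IsProbabilityMeasure μ] in
@[simp]
theorem jointMap_inl (A : POperator μ) {k : ℕ} (f : Fin k → Lp ℝ ∞ μ) (ω : Ω) (i : Fin k) :
    jointMap A f ω (Sum.inl i) = f i ω := rfl

omit [IsProbabilityMeasure μ] in
@[simp]
theorem jointMap_inr (A : POperator μ) {k : ℕ} (f : Fin k → Lp ℝ ∞ μ) (ω : Ω) (i : Fin k) :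
    jointMap A f ω (Sum.inr i) = A (f i) ω := rfl

end jointLaw

/-! ### Translated laws and rank one perturbations. -/

/-- Translation of the last `k` coordinates of `ℝ^{2k}` by `c`. -/
noncomputable def shiftImages {k : ℕ} (c : Fin k → ℝ) (x : EuclideanSpace ℝ (Fin k ⊕ Fin k)) :
    EuclideanSpace ℝ (Fin k ⊕ Fin k) :=
  x + WithLp.toLp 2 (Sum.elim (fun _ => 0) c)

theorem measurable_shiftImages {k : ℕ} (c : Fin k → ℝ) : Measurable (shiftImages c) :=
  measurable_id.add_const _

/-- The law of `(f₁, …, f_k, A f₁ + c₁, …, A f_k + c_k)`. -/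
noncomputable def shiftedLaw {Ω : Type*} {m : MeasurableSpace Ω} {μ : Measure Ω}
    [IsProbabilityMeasure μ] (A : POperator μ) {k : ℕ} (f : Fin k → Lp ℝ ∞ μ) (c : Fin k → ℝ) :
    ProbabilityMeasure (EuclideanSpace ℝ (Fin k ⊕ Fin k)) :=
  (jointLaw A f).map (measurable_shiftImages c).aemeasurable

theorem shiftedLaw_apply {Ω : Type*} {m : MeasurableSpace Ω} {μ : Measure Ω}
    [IsProbabilityMeasure μ] (A : POperator μ) {k : ℕ} (f : Fin k → Lp ℝ ∞ μ) (c : Fin k → ℝ)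
    {B : Set (EuclideanSpace ℝ (Fin k ⊕ Fin k))} (hB : MeasurableSet B) :
    (shiftedLaw A f c : Measure _) B = μ {ω | shiftImages c (jointMap A f ω) ∈ B} := by
  rw [shiftedLaw, ProbabilityMeasure.toMeasure_map, Measure.map_apply (measurable_shiftImages c) hB,
    jointLaw_apply A f (measurable_shiftImages c hB)]
  rfl

theorem edist_shiftedLaw_le {Ω Ω' : Type*} {m : MeasurableSpace Ω} {m' : MeasurableSpace Ω'}
    {μ : Measure Ω} {μ' : Measure Ω'} [IsProbabilityMeasure μ] [IsProbabilityMeasure μ']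
    (A : POperator μ) (A' : POperator μ') {k : ℕ} (f : Fin k → Lp ℝ ∞ μ) (f' : Fin k → Lp ℝ ∞ μ')
    (c : Fin k → ℝ) :
    edist (LevyProkhorov.ofMeasure (shiftedLaw A f c))
        (LevyProkhorov.ofMeasure (shiftedLaw A' f' c)) ≤
      edist (LevyProkhorov.ofMeasure (jointLaw A f)) (LevyProkhorov.ofMeasure (jointLaw A' f')) :=
  levyProkhorov_edist_map_le _ _ (measurable_shiftImages c) fun x y => by simp [shiftImages]

/-- `A` plus the rank one operator `g ↦ ψ(g) 𝟙`. -/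
noncomputable def addFunctional {Ω : Type*} {m : MeasurableSpace Ω} {μ : Measure Ω}
    [IsProbabilityMeasure μ] (A : POperator μ) (ψ : Lp ℝ ∞ μ →L[ℝ] ℝ) : POperator μ :=
  A + ψ.smulRight (Lp.const 1 μ (1 : ℝ))

theorem addFunctional_coeFn {Ω : Type*} {m : MeasurableSpace Ω} {μ : Measure Ω}
    [IsProbabilityMeasure μ] (A : POperator μ) (ψ : Lp ℝ ∞ μ →L[ℝ] ℝ) (f : Lp ℝ ∞ μ) :
    ∀ᵐ ω ∂μ, addFunctional A ψ f ω = A f ω + ψ f := by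
  have h0 : addFunctional A ψ f = A f + ψ f • Lp.const 1 μ (1 : ℝ) := rfl
  rw [h0]
  filter_upwards [Lp.coeFn_add (A f) (ψ f • Lp.const 1 μ (1 : ℝ)),
    Lp.coeFn_smul (ψ f) (Lp.const 1 μ (1 : ℝ)), Lp.coeFn_const (p := 1) (μ := μ) (1 : ℝ)]
    with ω h1 h2 h3
  rw [h1, Pi.add_apply, h2, Pi.smul_apply, h3]
  simp

/-- On the limit side the perturbation `ψ 𝟙` plays the role of the new vertex: it too only
translates the image coordinates. -/
theorem jointLaw_addFunctional {Ω : Type*} {m : MeasurableSpace Ω} {μ : Measure Ω}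
    [IsProbabilityMeasure μ] (A : POperator μ) (ψ : Lp ℝ ∞ μ →L[ℝ] ℝ) {k : ℕ}
    (f : Fin k → Lp ℝ ∞ μ) :
    jointLaw (addFunctional A ψ) f = shiftedLaw A f fun i => ψ (f i) := by
  refine Subtype.ext (Measure.ext fun B hB => ?_)
  refine (jointLaw_apply _ f hB).trans (Eq.trans ?_ (shiftedLaw_apply A f _ hB).symm)
  refine measure_congr ?_
  filter_upwards [ae_all_iff.2 fun i => addFunctional_coeFn A ψ (f i)] with ω hω
  have : jointMap (addFunctional A ψ) f ω = shiftImages (fun i => ψ (f i)) (jointMap A f ω) := by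
    ext (i | i)
    · simp [shiftImages]
    · simp [shiftImages, hω i]
  change (_ ∈ B) = (_ ∈ B)
  rw [this]

/-! ### Functions on finite graphs and the effect of a universal vertex. -/

section uniform

theorem uniformMeasure_apply {V : Type*} [Fintype V] [Nonempty V] (S : Set V) :
    uniformMeasure V S = (S.ncard : ℝ≥0∞) / Fintype.card V := by
  classical
  let _ : MeasurableSpace V := ⊤
  rw [uniformMeasure, PMF.toMeasure_uniformOfFintype_apply S MeasurableSpace.measurableSet_top, ← Nat.card_eq_fintype_card,
    Nat.card_coe_set_eq]

/-- The new vertex adds at most one to the count, and the denominator only grows. -/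
theorem uniformMeasure_option_le {V : Type*} [Fintype V] [Nonempty V] (S : Set (Option V)) :
    uniformMeasure (Option V) S ≤ uniformMeasure V (some ⁻¹' S) + (Fintype.card V : ℝ≥0∞)⁻¹ := by
  rw [uniformMeasure_apply, uniformMeasure_apply, ← one_div, ← ENNReal.add_div]
  have h1 : S.ncard ≤ (some ⁻¹' S).ncard + 1 := by
    have : S ⊆ insert none (some '' (some ⁻¹' S)) := by
      rintro (_ | x) hx
      · simp
      · exact Or.inr ⟨x, hx, rfl⟩
    refine (Set.ncard_le_ncard this (Set.toFinite _)).trans ((Set.ncard_insert_le _ _).trans ?_)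
    rw [Set.ncard_image_of_injective _ (Option.some_injective V)]
  refine ENNReal.div_le_div (by exact_mod_cast h1) ?_
  rw [Fintype.card_option]
  exact_mod_cast Nat.le_succ _

theorem adjacencyOperator_coeFn {V : Type*} [Fintype V] [Nonempty V] (G : SimpleGraph V)
    (f : Lp ℝ ∞ (uniformMeasure V)) (x : V) :
    adjacencyOperator G f x = adjacencyFun G f x :=
  forall_of_ae_uniformMeasure (memLp_uniformMeasure (adjacencyFun G f) 1).coeFn_toLp x

theorem adjacencyFun_addUniversalVertex_some {V : Type*} [Fintype V] (G : SimpleGraph V)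
    (f : Option V → ℝ) (x : V) :
    adjacencyFun G.addUniversalVertex f (some x) =
      adjacencyFun G (fun y => f (some y)) x + f none := by
  simp only [adjacencyFun, SimpleGraph.addUniversalVertex, Fintype.sum_option]
  rw [add_comm]
  congr 1
  exact if_pos trivial

/-- A function on a finite set as an element of `L^∞`. -/
noncomputable def uniformToLp {V : Type*} [Fintype V] [Nonempty V] (f : V → ℝ) :
    Lp ℝ ∞ (uniformMeasure V) :=
  (memLp_uniformMeasure f ∞).toLp

theorem uniformToLp_coeFn {V : Type*} [Fintype V] [Nonempty V] (f : V → ℝ) (x : V) :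
    uniformToLp f x = f x :=
  forall_of_ae_uniformMeasure (memLp_uniformMeasure f ∞).coeFn_toLp x

theorem norm_uniformToLp_le {V : Type*} [Fintype V] [Nonempty V] {f : V → ℝ}
    (hf : ∀ x, |f x| ≤ 1) : ‖uniformToLp f‖ ≤ 1 :=
  norm_le_of_ae_abs_le _ zero_le_one (Eventually.of_forall fun x => by
    rw [uniformToLp_coeFn]; exact hf x)

theorem abs_apply_le_norm_of_uniformMeasure {V : Type*} [Fintype V] [Nonempty V]
    (f : Lp ℝ ∞ (uniformMeasure V)) (x : V) : |f x| ≤ ‖f‖ :=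
  forall_of_ae_uniformMeasure (IsMeasureFilter.ae_abs_le_norm f) x

/-- The joint law of functions on `G⁺` is, up to an error `1 / |V(G)|`, the law of their restrictions
to `G`, shifted by the values at the new vertex. -/
theorem edist_jointLaw_addUniversalVertex_le {V : Type*} [Fintype V] [Nonempty V]
    (G : SimpleGraph V) {k : ℕ} (F : Fin k → Lp ℝ ∞ (uniformMeasure (Option V)))
    (f : Fin k → Lp ℝ ∞ (uniformMeasure V)) (hf : ∀ i x, f i x = F i (some x)) :
    edist (LevyProkhorov.ofMeasure (jointLaw (adjacencyOperator G.addUniversalVertex) F))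
      (LevyProkhorov.ofMeasure (shiftedLaw (adjacencyOperator G) f fun i => F i none)) ≤
      (Fintype.card V : ℝ≥0∞)⁻¹ := by
  refine levyProkhorov_edist_le fun ε B hε hε' hB => ?_
  rw [jointLaw_apply _ F hB, shiftedLaw_apply _ f _ Metric.isOpen_thickening.measurableSet]
  refine (uniformMeasure_option_le _).trans (add_le_add (measure_mono fun x hx => ?_) hε.le)
  have hpos : 0 < ε.toReal := ENNReal.toReal_pos (bot_le.trans_lt hε).ne' hε'.ne
  -- At old vertices the two maps agree exactly, so nothing has to move; the whole error is the mass
  -- of the new vertex.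
  refine Metric.self_subset_thickening hpos B ?_
  have : shiftImages (fun i => F i none) (jointMap (adjacencyOperator G) f x) =
      jointMap (adjacencyOperator G.addUniversalVertex) F (some x) := by
    ext (i | i)
    · simp [shiftImages, hf]
    · have hfi : (f i : V → ℝ) = fun y => F i (some y) := funext (hf i)
      simp [shiftImages, adjacencyOperator_coeFn, adjacencyFun_addUniversalVertex_some, hfi]
  change _ ∈ B
  rw [this]
  exact hx

end uniform

/-! ### Khintchine's inequality and operators on disjointly supported functions. -/

section khintchine

/-- The signed sum `∑_{i ∈ T} ±x_i`, with sign `+` exactly on `s`. -/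
noncomputable def signedSum {ι E : Type*} [DecidableEq ι] [AddCommGroup E] (T : Finset ι)
    (x : ι → E) (s : Finset ι) : E :=
  ∑ i ∈ T, if i ∈ s then x i else -x i

theorem signedSum_insert_of_notMem {ι E : Type*} [DecidableEq ι] [AddCommGroup E] {T : Finset ι}
    (x : ι → E) {s : Finset ι} {a : ι} (ha : a ∉ T) (hs : s ⊆ T) :
    signedSum (insert a T) x s = signedSum T x s - x a := by
  rw [signedSum, Finset.sum_insert ha, if_neg fun h => ha (hs h), signedSum]
  abel

theorem signedSum_insert_insert {ι E : Type*} [DecidableEq ι] [AddCommGroup E] {T : Finset ι}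
    (x : ι → E) {s : Finset ι} {a : ι} (ha : a ∉ T) :
    signedSum (insert a T) x (insert a s) = signedSum T x s + x a := by
  rw [signedSum, Finset.sum_insert ha, if_pos (Finset.mem_insert_self _ _), signedSum, add_comm]
  congr 1
  refine Finset.sum_congr rfl fun i hi => ?_
  have : i ≠ a := fun h => ha (h ▸ hi)
  simp [this]

/-- Subsets of `T` enumerate the sign patterns, so these are the second and fourth moments of a
Rademacher sum. A new index splits each pattern into two, and the odd powers of `x a` cancel. -/
theorem sum_signedSum_moments {ι : Type*} [DecidableEq ι] (T : Finset ι) (x : ι → ℝ) :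
    ∑ s ∈ T.powerset, signedSum T x s ^ 2 = 2 ^ T.card * ∑ i ∈ T, x i ^ 2 ∧
    ∑ s ∈ T.powerset, signedSum T x s ^ 4 ≤ 2 ^ T.card * (3 * (∑ i ∈ T, x i ^ 2) ^ 2) := by
  induction T using Finset.induction_on with
  | empty => simp [signedSum]
  | insert a T ha ih =>
    have h2 : ∀ p : ℕ, ∑ s ∈ (insert a T).powerset, signedSum (insert a T) x s ^ p =
        ∑ s ∈ T.powerset, ((signedSum T x s - x a) ^ p + (signedSum T x s + x a) ^ p) := by
      intro p
      rw [Finset.sum_powerset_insert ha, ← Finset.sum_add_distrib]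
      refine Finset.sum_congr rfl fun s hs => ?_
      rw [signedSum_insert_of_notMem x ha (Finset.mem_powerset.1 hs), signedSum_insert_insert x ha]
    have hc : ((2 : ℝ) ^ T.card) = T.powerset.card := by
      rw [Finset.card_powerset]; push_cast; rfl
    have h3 : ∑ s ∈ T.powerset, ((signedSum T x s - x a) ^ 2 + (signedSum T x s + x a) ^ 2) =
        2 * ∑ s ∈ T.powerset, signedSum T x s ^ 2 + 2 * 2 ^ T.card * x a ^ 2 := by
      rw [Finset.mul_sum, hc, show (2 : ℝ) * (T.powerset.card : ℝ) * x a ^ 2 = ∑ s ∈ T.powerset, 2 * x a ^ 2 by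
        rw [Finset.sum_const, nsmul_eq_mul]; ring, ← Finset.sum_add_distrib]
      exact Finset.sum_congr rfl fun s _ => by ring
    have h4 : ∑ s ∈ T.powerset, ((signedSum T x s - x a) ^ 4 + (signedSum T x s + x a) ^ 4) =
        2 * ∑ s ∈ T.powerset, signedSum T x s ^ 4 +
          12 * x a ^ 2 * ∑ s ∈ T.powerset, signedSum T x s ^ 2 + 2 * 2 ^ T.card * x a ^ 4 := by
      rw [Finset.mul_sum, Finset.mul_sum, hc,
        show (2 : ℝ) * (T.powerset.card : ℝ) * x a ^ 4 = ∑ s ∈ T.powerset, 2 * x a ^ 4 by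
        rw [Finset.sum_const, nsmul_eq_mul]; ring, ← Finset.sum_add_distrib,
        ← Finset.sum_add_distrib]
      exact Finset.sum_congr rfl fun s _ => by ring
    rw [h2, h2, h3, h4, Finset.sum_insert ha, Finset.card_insert_of_notMem ha, ih.1]
    refine ⟨by ring, ?_⟩
    have h5 := ih.2
    have h6 : (0 : ℝ) < 2 ^ T.card := by positivity
    set q := ∑ i ∈ T, x i ^ 2
    -- The recursion gives `3q² + 6q x_a² + x_a⁴`, against the target `3(q + x_a²)²`; a multiple of
    -- `x_a⁴` is the slack.
    have h7 : 0 ≤ (2 : ℝ) ^ T.card * x a ^ 4 := by positivity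
    rw [pow_succ 2 T.card]
    nlinarith

/-- Khintchine's inequality in `L¹`. -/
theorem le_sum_abs_signedSum {ι : Type*} [DecidableEq ι] (T : Finset ι) (x : ι → ℝ) :
    2 ^ T.card * (√(∑ i ∈ T, x i ^ 2) / 4) ≤ ∑ s ∈ T.powerset, |signedSum T x s| := by
  obtain ⟨h2, h4⟩ := sum_signedSum_moments T x
  set q := ∑ i ∈ T, x i ^ 2
  have hq : 0 ≤ q := Finset.sum_nonneg fun i _ => sq_nonneg _
  rcases hq.eq_or_lt with hq0 | hq0
  · rw [← hq0]
    simpa using Finset.sum_nonneg fun s _ => abs_nonneg (signedSum T x s)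
  set r := √q with hr
  have hrpos : 0 < r := Real.sqrt_pos.2 hq0
  have hrq : r ^ 2 = q := Real.sq_sqrt hq
  -- A lower bound for `|y|` by even moments. Averaging over the signs gives at least `r⁴ - (3/4) r⁴
  -- = r⁴/4`, hence the constant 4.
  have hpt : ∀ y : ℝ, y ^ 2 * r ^ 2 - y ^ 4 / 4 ≤ |y| * r ^ 3 := by
    intro y
    rw [← sq_abs y, show y ^ 4 = |y| ^ 4 by rw [← abs_pow, abs_of_nonneg (by positivity)]]
    set z := |y|
    have hz : 0 ≤ z := abs_nonneg y
    have h : 0 ≤ r ^ 3 - z * r ^ 2 + z ^ 3 / 4 := by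
      nlinarith [mul_nonneg hz (sq_nonneg (z - r)), mul_nonneg hrpos.le (sq_nonneg (z - r)),
        pow_pos hrpos 3]
    nlinarith [mul_nonneg hz h]
  have hsum := Finset.sum_le_sum fun s (_ : s ∈ T.powerset) => hpt (signedSum T x s)
  rw [Finset.sum_sub_distrib, ← Finset.sum_mul, ← Finset.sum_div, ← Finset.sum_mul, h2] at hsum
  have h6 : (2 : ℝ) ^ T.card * (r / 4) * r ^ 3 ≤ (∑ s ∈ T.powerset, |signedSum T x s|) * r ^ 3 := by
    rw [← hrq] at h4 hsum
    nlinarith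
  exact le_of_mul_le_mul_right h6 (by positivity)

/-- Cauchy–Schwarz followed by Khintchine. The factor `√n`, rather than `n`, is what makes the later
counting argument work. -/
theorem le_sum_abs_signedSum_of_sum_abs {ι : Type*} [DecidableEq ι] (T : Finset ι) (x : ι → ℝ) :
    2 ^ T.card * ∑ i ∈ T, |x i| ≤ 4 * √T.card * ∑ s ∈ T.powerset, |signedSum T x s| := by
  have h1 : ∑ i ∈ T, |x i| ≤ √T.card * √(∑ i ∈ T, x i ^ 2) := by
    rw [← Real.sqrt_mul (Nat.cast_nonneg _)]
    refine Real.le_sqrt_of_sq_le ?_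
    simpa using sq_sum_le_card_mul_sum_sq (s := T) (f := fun i => |x i|)
  have h2 := le_sum_abs_signedSum T x
  calc 2 ^ T.card * ∑ i ∈ T, |x i| ≤ 2 ^ T.card * (√T.card * √(∑ i ∈ T, x i ^ 2)) := by gcongr
    _ = 4 * √T.card * (2 ^ T.card * (√(∑ i ∈ T, x i ^ 2) / 4)) := by ring
    _ ≤ _ := by gcongr

theorem coeFn_signedSum {Ω : Type*} {m : MeasurableSpace Ω} {μ : Measure Ω} {p : ℝ≥0∞}
    {ι : Type*} [DecidableEq ι] (T : Finset ι) (u : ι → Lp ℝ p μ) (s : Finset ι) :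
    ∀ᵐ ω ∂μ, signedSum T u s ω = signedSum T (fun i => u i ω) s := by
  induction T using Finset.induction_on with
  | empty =>
    simp only [signedSum, Finset.sum_empty]
    filter_upwards [Lp.coeFn_zero ℝ p μ] with ω hω
    simpa using hω
  | insert a T ha ih =>
    have h0 : signedSum (insert a T) u s = (if a ∈ s then u a else -u a) + signedSum T u s := by
      rw [signedSum, Finset.sum_insert ha, signedSum]
    rw [h0]
    filter_upwards [ih, Lp.coeFn_add (if a ∈ s then u a else -u a) (signedSum T u s),
      Lp.coeFn_neg (u a)] with ω h1 h2 h3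
    rw [h2, Pi.add_apply, h1, signedSum, signedSum, Finset.sum_insert ha]
    congr 1
    split_ifs
    · rfl
    · rw [h3]; rfl

/-- If all signed sums of finitely many elements of `L¹` have norm at most `C`, then the sum of the
norms is at most `4 √n C`. -/
theorem sum_norm_le_of_signedSum_le {Ω : Type*} {m : MeasurableSpace Ω} {μ : Measure Ω}
    {ι : Type*} [DecidableEq ι] (T : Finset ι) (u : ι → Lp ℝ 1 μ) {C : ℝ}
    (h : ∀ s, ‖signedSum T u s‖ ≤ C) : ∑ i ∈ T, ‖u i‖ ≤ 4 * √T.card * C := by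
  have hint : ∀ s, Integrable (fun ω => |signedSum T (fun i => u i ω) s|) μ := fun s =>
    ((L1.integrable_coeFn (signedSum T u s)).congr (coeFn_signedSum T u s)).abs
  have h1 : ∫ ω, 2 ^ T.card * ∑ i ∈ T, |u i ω| ∂μ ≤
      ∫ ω, 4 * √T.card * ∑ s ∈ T.powerset, |signedSum T (fun i => u i ω) s| ∂μ := by
    refine integral_mono ?_ ?_ fun ω => le_sum_abs_signedSum_of_sum_abs T fun i => u i ω
    · exact (integrable_finsetSum _ fun i _ => (L1.integrable_coeFn (u i)).abs).const_mul _
    · exact (integrable_finsetSum _ fun s _ => hint s).const_mul _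
  rw [integral_const_mul, integral_const_mul,
    integral_finsetSum _ fun i _ => (L1.integrable_coeFn (u i)).abs,
    integral_finsetSum _ fun s _ => hint s] at h1
  have h2 : ∀ s, ∫ ω, |signedSum T (fun i => u i ω) s| ∂μ ≤ C := fun s => by
    refine le_trans (le_of_eq ?_) (h s)
    rw [L1.norm_eq_integral_norm]
    refine integral_congr_ae ?_
    filter_upwards [coeFn_signedSum T u s] with ω hω
    rw [hω, Real.norm_eq_abs]
  have h3 : ∀ i, ∫ ω, |u i ω| ∂μ = ‖u i‖ := fun i => by
    rw [L1.norm_eq_integral_norm]; rfl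
  simp only [h3] at h1
  have h4 : ∑ s ∈ T.powerset, ∫ ω, |signedSum T (fun i => u i ω) s| ∂μ ≤ 2 ^ T.card * C := by
    refine (Finset.sum_le_card_nsmul _ _ C fun s _ => h2 s).trans_eq ?_
    simp
  have h5 := h1.trans (mul_le_mul_of_nonneg_left h4 (by positivity))
  have h6 : (0 : ℝ) < 2 ^ T.card := by positivity
  refine le_of_mul_le_mul_left (h5.trans_eq ?_) h6
  ring

/-- A bounded operator `L^∞ → L¹` is small on functions supported on all but finitely many of a
sequence of disjoint sets. -/
theorem exists_norm_map_le_of_disjoint {Ω : Type*} {m : MeasurableSpace Ω} {μ : Measure Ω}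
    [IsProbabilityMeasure μ] (A : POperator μ) (E : ℕ → Set Ω)
    (hE : Pairwise (Function.onFun Disjoint E)) {δ : ℝ} (hδ : 0 < δ) :
    ∃ j, ∀ h : Lp ℝ ∞ μ, ‖h‖ ≤ 1 → (∀ᵐ ω ∂μ, ω ∉ E j → h ω = 0) → ‖A h‖ ≤ δ := by
  by_contra! hcon
  choose h hh1 hsupp hbig using hcon
  have key : ∀ n : ℕ, n * δ ≤ 4 * √n * ‖A‖ := by
    intro n
    -- Signed sums of disjointly supported unit-ball functions stay in the unit ball, because at
    -- almost every point at most one term is nonzero.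
    have h1 : ∀ s, ‖signedSum (Finset.range n) (fun i => A (h i)) s‖ ≤ ‖A‖ := by
      intro s
      have h2 : signedSum (Finset.range n) (fun i => A (h i)) s =
          A (signedSum (Finset.range n) h s) := by
        rw [signedSum, signedSum, map_sum]
        refine Finset.sum_congr rfl fun i _ => ?_
        split_ifs <;> simp
      rw [h2]
      refine (A.le_opNorm _).trans (mul_le_of_le_one_right (norm_nonneg _) ?_)
      refine norm_le_of_ae_abs_le _ zero_le_one ?_
      filter_upwards [coeFn_signedSum (Finset.range n) h s, ae_all_iff.2 hsupp,
        ae_all_iff.2 fun i => IsMeasureFilter.ae_abs_le_norm (h i)] with ω h3 h4 h5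
      rw [h3, signedSum]
      by_cases hω : ∃ i ∈ Finset.range n, ω ∈ E i
      · obtain ⟨i, hi, hiE⟩ := hω
        rw [Finset.sum_eq_single_of_mem i hi]
        · have := (h5 i).trans (hh1 i)
          split_ifs
          · exact this
          · rwa [abs_neg]
        · intro j _ hji
          rw [h4 j fun hj => Set.disjoint_left.1 (hE hji) hj hiE]
          simp
      · push Not at hω
        rw [Finset.sum_eq_zero]
        · simp
        · intro i hi
          rw [h4 i (hω i hi)]
          simp
    have h2 := sum_norm_le_of_signedSum_le (Finset.range n) (fun i => A (h i)) h1
    rw [Finset.card_range] at h2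
    refine le_trans ?_ h2
    simpa using Finset.card_nsmul_le_sum (Finset.range n) (fun i => ‖A (h i)‖) δ
      fun i _ => (hbig i).le
  obtain ⟨N, hN⟩ := exists_nat_gt (4 * ‖A‖ / δ)
  rw [div_lt_iff₀ hδ] at hN
  -- A perfect square makes the root exact: `(N+1) δ ≤ 4 ‖A‖`, against the choice of `N`.
  have h1 := key ((N + 1) ^ 2)
  push_cast at h1
  rw [Real.sqrt_sq (by positivity)] at h1
  have h2 : (0 : ℝ) < N + 1 := by positivity
  nlinarith

end khintchine

/-! ### The action distance and the comparison of profiles. -/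

section action

variable {Ω Ω' : Type*} {m : MeasurableSpace Ω} {m' : MeasurableSpace Ω'}
  {μ : Measure Ω} {μ' : Measure Ω'} [IsProbabilityMeasure μ] [IsProbabilityMeasure μ']

theorem tsum_two_pow_inv : ∑' j : ℕ, (1 : ℝ≥0∞) / 2 ^ (j + 1) = 1 := by
  simpa [ENNReal.inv_pow, ENNReal.inv_mul_cancel] using
    ENNReal.tsum_geometric_add_one (2⁻¹ : ℝ≥0∞)

theorem hausdorffEDist_kProfile_le (A : POperator μ) (B : POperator μ') (j : ℕ) :
    Metric.hausdorffEDist (kProfile A (j + 1)) (kProfile B (j + 1)) ≤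
      2 ^ (j + 1) * actionDist A B := by
  have h := ENNReal.le_tsum (f := fun j : ℕ =>
    Metric.hausdorffEDist (kProfile A (j + 1)) (kProfile B (j + 1)) / 2 ^ (j + 1)) j
  rw [ENNReal.div_le_iff (by simp) (by simp)] at h
  rwa [mul_comm]

theorem hausdorffEDist_kProfile_le_one (A : POperator μ) (B : POperator μ') (k : ℕ) :
    Metric.hausdorffEDist (kProfile A k) (kProfile B k) ≤ 1 := by
  refine Metric.hausdorffEDist_le_of_mem_edist (fun P _ => ?_) fun P _ => ?_
  · obtain ⟨Q, hQ⟩ := kProfile_nonempty B k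
    exact ⟨Q, hQ, levyProkhorov_edist_le_one P Q⟩
  · obtain ⟨Q, hQ⟩ := kProfile_nonempty A k
    exact ⟨Q, hQ, levyProkhorov_edist_le_one P Q⟩

theorem actionDist_comm (A : POperator μ) (B : POperator μ') : actionDist A B = actionDist B A := by
  simp only [actionDist, Metric.hausdorffEDist_comm]

theorem actionDist_triangle {Ω'' : Type*} {m'' : MeasurableSpace Ω''} {μ'' : Measure Ω''}
    [IsProbabilityMeasure μ''] (A : POperator μ) (B : POperator μ') (C : POperator μ'') :
    actionDist A C ≤ actionDist A B + actionDist B C := by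
  rw [actionDist, actionDist, actionDist, ← ENNReal.tsum_add]
  refine ENNReal.tsum_le_tsum fun j => ?_
  rw [← ENNReal.add_div]
  exact ENNReal.div_le_div_right Metric.hausdorffEDist_triangle _

/-- The weights `2^{-k}` sum to one, so an error `r` that is uniform in `k` costs exactly `r`. -/
theorem actionDist_le_add_of_forall {Ω₁ Ω₂ : Type*} {m₁ : MeasurableSpace Ω₁}
    {m₂ : MeasurableSpace Ω₂} {μ₁ : Measure Ω₁} {μ₂ : Measure Ω₂} [IsProbabilityMeasure μ₁]
    [IsProbabilityMeasure μ₂] {A : POperator μ} {B : POperator μ'} {A₁ : POperator μ₁}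
    {B₁ : POperator μ₂} {r : ℝ≥0∞}
    (h : ∀ k, Metric.hausdorffEDist (kProfile A k) (kProfile B k) ≤
      r + Metric.hausdorffEDist (kProfile A₁ k) (kProfile B₁ k)) :
    actionDist A B ≤ r + actionDist A₁ B₁ := by
  have h1 : r = ∑' j : ℕ, r / 2 ^ (j + 1) := by
    conv_lhs => rw [← mul_one r, ← tsum_two_pow_inv, ← ENNReal.tsum_mul_left]
    simp only [mul_div, mul_one]
  conv_rhs => rw [h1]
  rw [actionDist, actionDist, ← ENNReal.tsum_add]
  refine ENNReal.tsum_le_tsum fun j => ?_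
  rw [← ENNReal.add_div]
  exact ENNReal.div_le_div_right (h _) _

theorem ActionConverges.weaklyEquivalent {Ωs : ℕ → Type*} {ms : ∀ n, MeasurableSpace (Ωs n)}
    {μs : ∀ n, Measure (Ωs n)} [∀ n, IsProbabilityMeasure (μs n)] {As : ∀ n, POperator (μs n)}
    {A : POperator μ} {B : POperator μ'} (hA : ActionConverges As A) (hB : ActionConverges As B) :
    WeaklyEquivalent A B := by
  have h : Tendsto (fun n => actionDist (As n) A + actionDist (As n) B) atTop (𝓝 (0 + 0)) :=
    Tendsto.add hA hB
  rw [add_zero] at h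
  refine le_antisymm (ge_of_tendsto' h fun n => ?_) bot_le
  rw [actionDist_comm (As n) A]
  exact actionDist_triangle A (As n) B

theorem ActionConverges.tendsto_hausdorffEDist {Ωs : ℕ → Type*} {ms : ∀ n, MeasurableSpace (Ωs n)}
    {μs : ∀ n, Measure (Ωs n)} [∀ n, IsProbabilityMeasure (μs n)] {As : ∀ n, POperator (μs n)}
    {A : POperator μ} (hA : ActionConverges As A) (j : ℕ) :
    Tendsto (fun n => Metric.hausdorffEDist (kProfile (As n) (j + 1)) (kProfile A (j + 1)))
      atTop (𝓝 0) := by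
  have h : Tendsto (fun n => 2 ^ (j + 1) * actionDist (As n) A) atTop (𝓝 (2 ^ (j + 1) * 0)) :=
    ENNReal.Tendsto.const_mul hA (Or.inr (by simp))
  rw [mul_zero] at h
  exact tendsto_of_tendsto_of_tendsto_of_le_of_le tendsto_const_nhds h (fun _ => bot_le)
    fun n => hausdorffEDist_kProfile_le _ _ j

/-- Dominated convergence for counting measure: each Hausdorff distance is at most 1, so `2^{-k}`
dominates the terms. -/
theorem actionConverges_of_tendsto_hausdorffEDist {Ωs : ℕ → Type*}
    {ms : ∀ n, MeasurableSpace (Ωs n)}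
    {μs : ∀ n, Measure (Ωs n)} [∀ n, IsProbabilityMeasure (μs n)] {As : ∀ n, POperator (μs n)}
    {A : POperator μ}
    (h : ∀ k, Tendsto (fun n => Metric.hausdorffEDist (kProfile (As n) k) (kProfile A k))
      atTop (𝓝 0)) : ActionConverges As A := by
  have key := tendsto_lintegral_of_dominated_convergence (μ := Measure.count)
    (F := fun n j => Metric.hausdorffEDist (kProfile (As n) (j + 1)) (kProfile A (j + 1)) /
      2 ^ (j + 1)) (f := fun _ => 0) (fun j : ℕ => (1 : ℝ≥0∞) / 2 ^ (j + 1))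
    (fun n => measurable_from_top)
    (fun n => Eventually.of_forall fun j =>
      ENNReal.div_le_div_right (hausdorffEDist_kProfile_le_one _ _ _) _)
    (by rw [lintegral_count, tsum_two_pow_inv]; simp)
    (Eventually.of_forall fun j => by
      simpa using ENNReal.Tendsto.div_const (h (j + 1)) (b := 2 ^ (j + 1)) (Or.inr (by simp)))
  simpa [lintegral_count, ActionConverges, actionDist] using key

/-- If `ψ` can be prescribed on the unit ball of `L^∞` up to small changes of the functions and of
their images under `A`, then `A + ψ 𝟙` relates to `G⁺` as `A` does to `G`. -/
theorem hausdorffEDist_kProfile_addUniversalVertex_le {V : Type*} [Fintype V] [Nonempty V]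
    (G : SimpleGraph V) (A : POperator μ) (ψ : Lp ℝ ∞ μ →L[ℝ] ℝ)
    (hψ : ∀ f, ‖f‖ ≤ 1 → |ψ f| ≤ 1) (k : ℕ)
    (happrox : ∀ (g : Fin k → Lp ℝ ∞ μ) (c : Fin k → ℝ), (∀ i, ‖g i‖ ≤ 1) → (∀ i, |c i| ≤ 1) →
      ∀ δ : ℝ, 0 < δ → ∃ g' : Fin k → Lp ℝ ∞ μ, (∀ i, ‖g' i‖ ≤ 1) ∧ (∀ i, ψ (g' i) = c i) ∧
        edist (LevyProkhorov.ofMeasure (jointLaw A g)) (LevyProkhorov.ofMeasure (jointLaw A g')) ≤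
          ENNReal.ofReal δ) :
    Metric.hausdorffEDist (kProfile (adjacencyOperator G.addUniversalVertex) k)
        (kProfile (addFunctional A ψ) k) ≤
      (Fintype.card V : ℝ≥0∞)⁻¹ +
        Metric.hausdorffEDist (kProfile (adjacencyOperator G) k) (kProfile A k) := by
  set d := Metric.hausdorffEDist (kProfile (adjacencyOperator G) k) (kProfile A k) with hd
  have hd1 : d ≠ ∞ := ((hausdorffEDist_kProfile_le_one _ _ _).trans_lt ENNReal.one_lt_top).ne
  refine ENNReal.le_of_forall_pos_le_add fun ε hε _ => ?_
  have hε2 : (0 : ℝ≥0∞) < ε / 2 := ENNReal.div_pos (by simpa using hε.ne') (by simp)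
  have hlt : d < d + ε / 2 := ENNReal.lt_add_right hd1 hε2.ne'
  refine Metric.hausdorffEDist_le_of_mem_edist ?_ ?_
  · rintro _ ⟨F, hF, rfl⟩
    -- From `G⁺` to `A + ψ 𝟙`: restrict to the old vertices, match the restriction by `g` under `A`,
    -- then alter `g` so that `ψ` reproduces the values at the new vertex.
    set c : Fin k → ℝ := fun i => F i none
    set f : Fin k → Lp ℝ ∞ (uniformMeasure V) := fun i => uniformToLp fun x => F i (some x)
    have hf : ∀ i, ‖f i‖ ≤ 1 := fun i => norm_uniformToLp_le fun x =>
      (abs_apply_le_norm_of_uniformMeasure (F i) _).trans (hF i)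
    obtain ⟨_, ⟨g, hg, rfl⟩, hfg⟩ := Metric.exists_edist_lt_of_hausdorffEDist_lt
      (jointLaw_mem_kProfile (adjacencyOperator G) hf) hlt
    obtain ⟨g', hg', hψg', hgg'⟩ := happrox g c hg
      (fun i => (abs_apply_le_norm_of_uniformMeasure (F i) none).trans (hF i)) (ε / 2)
      (by positivity)
    refine ⟨_, jointLaw_mem_kProfile _ hg', ?_⟩
    rw [jointLaw_addFunctional]
    simp only [hψg']
    have h1 := edist_jointLaw_addUniversalVertex_le G F f fun i x => uniformToLp_coeFn _ _
    have h2 := edist_shiftedLaw_le (adjacencyOperator G) A f g c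
    have h3 := edist_shiftedLaw_le A A g g' c
    have h4 : ENNReal.ofReal ((ε : ℝ) / 2) = ε / 2 := by
      rw [ENNReal.ofReal_div_of_pos two_pos]; simp
    rw [h4] at hgg'
    refine (edist_triangle4 _ _ _ _).trans
      ((add_le_add (add_le_add h1 (h2.trans hfg.le)) (h3.trans hgg')).trans_eq ?_)
    rw [add_assoc, add_assoc, ENNReal.add_halves, ← add_assoc]
  · rintro _ ⟨g, hg, rfl⟩
    rw [Metric.hausdorffEDist_comm] at hd
    obtain ⟨_, ⟨f, hf, rfl⟩, hgf⟩ := Metric.exists_edist_lt_of_hausdorffEDist_lt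
      (jointLaw_mem_kProfile A hg) (hd ▸ hlt)
    -- Conversely, match `g` on `G` and put `ψ (g i)` at the new vertex; `hψ` keeps the extension in
    -- the unit ball.
    set F : Fin k → Lp ℝ ∞ (uniformMeasure (Option V)) := fun i =>
      uniformToLp fun x => x.elim (ψ (g i)) (f i)
    have hF : ∀ i, ‖F i‖ ≤ 1 := fun i => norm_uniformToLp_le fun x => by
      cases x with
      | none => exact hψ _ (hg i)
      | some x => exact (abs_apply_le_norm_of_uniformMeasure (f i) x).trans (hf i)
    refine ⟨_, jointLaw_mem_kProfile _ hF, ?_⟩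
    rw [jointLaw_addFunctional]
    have h1 := edist_jointLaw_addUniversalVertex_le G F f fun i x =>
      (uniformToLp_coeFn (fun x : Option V => x.elim (ψ (g i)) (f i)) (some x)).symm
    have hnone : (fun i => F i none) = fun i => ψ (g i) := funext fun i => uniformToLp_coeFn _ none
    rw [hnone, edist_comm] at h1
    have h2 := (edist_shiftedLaw_le A (adjacencyOperator G) g f fun i => ψ (g i)).trans hgf.le
    refine (edist_triangle _ _ _).trans ((add_le_add h2 h1).trans ?_)
    rw [add_comm _ (Fintype.card V : ℝ≥0∞)⁻¹, ← add_assoc]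
    exact add_le_add (add_le_add le_rfl hd.ge) ENNReal.half_le_self

end action

/-! ### Atomlessness of the limit space and construction of the filter. -/

section atomless

theorem ncard_le_of_injective_of_mem_Icc {V : Type*} {e : V → ℤ}
    (he : Function.Injective e) {S : Set V} {a b : ℝ} (hab : a ≤ b)
    (h : ∀ x ∈ S, a ≤ e x ∧ (e x : ℝ) ≤ b) : (S.ncard : ℝ) ≤ b - a + 1 := by
  have h1 : S.ncard ≤ (Finset.Icc ⌈a⌉ ⌊b⌋ : Set ℤ).ncard :=
    Set.ncard_le_ncard_of_injOn e (fun x hx => by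
      simpa [Int.ceil_le, Int.le_floor] using h x hx) he.injOn (Finset.finite_toSet _)
  rw [Set.ncard_coe_finset, Int.card_Icc] at h1
  have h2 : (S.ncard : ℝ) ≤ ((⌊b⌋ + 1 - ⌈a⌉).toNat : ℤ) := by exact_mod_cast h1
  refine h2.trans ?_
  rw [Int.toNat_eq_max]
  push_cast
  have := Int.floor_le b
  have := Int.le_ceil a
  exact max_le (by linarith) (by linarith)

/-- The space of an action limit of graphs whose order tends to infinity is atomless. -/
theorem ActionConverges.exists_cover_measure_le {V : ℕ → Type*} [∀ n, Fintype (V n)]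
    [∀ n, Nonempty (V n)] {G : ∀ n, SimpleGraph (V n)} {Ω : Type*} {m : MeasurableSpace Ω}
    {ν : Measure Ω} [IsProbabilityMeasure ν] {A : POperator ν}
    (hV : Tendsto (fun n => Fintype.card (V n)) atTop atTop)
    (hA : ActionConverges (fun n => adjacencyOperator (G n)) A) {δ : ℝ} (hδ : 0 < δ) :
    ∃ D : ℤ → Set Ω, (∀ j, MeasurableSet (D j)) ∧ ⋃ j, D j = Set.univ ∧
      ∀ j, ν (D j) ≤ ENNReal.ofReal δ := by
  -- A strip of width `r`, thickened by `r` on both sides, has width `3r`; counting integers adds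
  -- one point, at most `rN` of them, and the Lévy–Prokhorov error adds `r`.
  set r := δ / 5 with hr
  have hrpos : 0 < r := by positivity
  obtain ⟨n, hn1, hn2⟩ := ((hA.tendsto_hausdorffEDist 0).eventually_lt_const
    (ENNReal.ofReal_pos.2 hrpos) |>.and (hV.eventually_ge_atTop ⌈1 / r⌉₊)).exists
  set N := Fintype.card (V n)
  have hN0 : (0 : ℝ) < N := by exact_mod_cast Fintype.card_pos
  have hNr : 1 ≤ r * N := by
    have : 1 / r ≤ N := (Nat.le_ceil _).trans (by exact_mod_cast hn2)
    rwa [div_le_iff₀' hrpos] at this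
  set e : V n → ℤ := fun x => (Fintype.equivFin (V n) x : ℕ)
  have he : Function.Injective e := fun x y h => by
    simpa [e, Fin.val_inj] using h
  have heN : ∀ x, 0 ≤ e x ∧ e x < N := fun x => by
    simp only [e]
    exact ⟨by positivity, by exact_mod_cast (Fintype.equivFin (V n) x).2⟩
  -- Equally spaced values in `[0,1]`; the level strips of an approximating function on `Ω` are then
  -- all of small measure.
  set f : Fin 1 → Lp ℝ ∞ (uniformMeasure (V n)) := fun _ => uniformToLp fun x => e x / N
  have hf : ∀ i, ‖f i‖ ≤ 1 := fun i => norm_uniformToLp_le fun x => by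
    have h1 : (0 : ℝ) ≤ e x := by exact_mod_cast (heN x).1
    have h2 : (e x : ℝ) ≤ N := by exact_mod_cast (heN x).2.le
    rw [abs_of_nonneg (by positivity)]
    exact div_le_one_of_le₀ h2 hN0.le
  obtain ⟨_, ⟨g, hg, rfl⟩, hfg⟩ := Metric.exists_edist_lt_of_hausdorffEDist_lt
    (jointLaw_mem_kProfile (adjacencyOperator (G n)) hf) hn1
  rw [edist_comm] at hfg
  refine ⟨fun j => {ω | ⌊g 0 ω / r⌋ = j}, fun j => ?_, ?_, fun j => ?_⟩
  · exact measurableSet_eq_fun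
      (Int.measurable_floor.comp ((IsMeasureFilter.measurable_coe (g 0)).div_const _))
      measurable_const
  · exact Set.eq_univ_of_forall fun ω => Set.mem_iUnion.2 ⟨_, rfl⟩
  · set B : Set (EuclideanSpace ℝ (Fin (0 + 1) ⊕ Fin (0 + 1))) :=
      {y | ⌊y (Sum.inl 0) / r⌋ = j} with hB
    have hBm : MeasurableSet B := by
      refine measurableSet_eq_fun (Int.measurable_floor.comp (Measurable.div_const ?_ _))
        measurable_const
      exact (measurable_pi_apply _).comp (WithLp.measurable_ofLp 2 _)
    have h1 := levyProkhorov_le_of_edist_lt hfg hBm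
    rw [jointLaw_apply A g hBm, ENNReal.toReal_ofReal hrpos.le,
      jointLaw_apply _ f Metric.isOpen_thickening.measurableSet] at h1
    refine h1.trans ?_
    set S := jointMap (adjacencyOperator (G n)) f ⁻¹' Metric.thickening r B
    have h2 : ∀ x ∈ S, (j - 1) * (r * N) ≤ e x ∧ (e x : ℝ) ≤ (j + 2) * (r * N) := by
      intro x hx
      obtain ⟨y, hy, hxy⟩ := Metric.mem_thickening_iff.1 hx
      have h3 := (abs_apply_le_dist _ _ (Sum.inl 0)).trans_lt hxy
      rw [jointMap_inl, uniformToLp_coeFn, abs_lt] at h3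
      rw [hB, Set.mem_ofPred_eq, Int.floor_eq_iff, le_div_iff₀ hrpos, div_lt_iff₀ hrpos] at hy
      have h4 : (e x : ℝ) = e x / N * N := by field_simp
      rw [h4]
      constructor
      · rw [← mul_assoc]
        refine mul_le_mul_of_nonneg_right ?_ hN0.le
        linarith
      · rw [← mul_assoc]
        refine mul_le_mul_of_nonneg_right ?_ hN0.le
        linarith
    have h5 := ncard_le_of_injective_of_mem_Icc he (by nlinarith) h2
    have h6 : uniformMeasure (V n) S ≤ ENNReal.ofReal (4 * r) := by
      rw [uniformMeasure_apply, ENNReal.div_le_iff (by simp) (by simp),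
        ← ENNReal.ofReal_natCast, ← ENNReal.ofReal_natCast, ← ENNReal.ofReal_mul (by positivity)]
      refine ENNReal.ofReal_le_ofReal (h5.trans ?_)
      change _ ≤ 4 * r * N
      linarith
    refine (add_le_add h6 le_rfl).trans ?_
    rw [← ENNReal.ofReal_add (by positivity) hrpos.le]
    exact ENNReal.ofReal_le_ofReal (by linarith)

variable {Ω : Type*} {m : MeasurableSpace Ω} {ν : Measure Ω} [IsProbabilityMeasure ν]

omit [IsProbabilityMeasure ν] in
-- The cover is countable, so some cell meets `E` in positive measure.
theorem exists_subset_measure_le {δ : ℝ}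
    (h : ∃ D : ℤ → Set Ω, (∀ j, MeasurableSet (D j)) ∧ ⋃ j, D j = Set.univ ∧
      ∀ j, ν (D j) ≤ ENNReal.ofReal δ)
    {E : Set Ω} (hE : MeasurableSet E) (hE0 : 0 < ν E) :
    ∃ E' ⊆ E, MeasurableSet E' ∧ 0 < ν E' ∧ ν E' ≤ ENNReal.ofReal δ := by
  obtain ⟨D, hD, hD', hDδ⟩ := h
  have h1 : ν (⋃ j, E ∩ D j) ≠ 0 := by
    rw [← Set.inter_iUnion, hD', Set.inter_univ]
    exact hE0.ne'
  obtain ⟨j, hj⟩ := exists_measure_pos_of_not_measure_iUnion_null h1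
  exact ⟨E ∩ D j, Set.inter_subset_left, hE.inter (hD j), hj,
    (measure_mono Set.inter_subset_right).trans (hDδ j)⟩

/-- In an atomless space, every set of positive measure has a small subset of positive measure on
which a given bounded operator is small. -/
theorem exists_subset_measure_le_norm_map_le (A : POperator ν)
    (h : ∀ δ : ℝ, 0 < δ → ∃ D : ℤ → Set Ω, (∀ j, MeasurableSet (D j)) ∧ ⋃ j, D j = Set.univ ∧
      ∀ j, ν (D j) ≤ ENNReal.ofReal δ)
    {δ : ℝ} (hδ : 0 < δ) {E : Set Ω} (hE : MeasurableSet E) (hE0 : 0 < ν E) :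
    ∃ E' ⊆ E, MeasurableSet E' ∧ 0 < ν E' ∧ ν E' ≤ ENNReal.ofReal δ ∧
      ∀ h : Lp ℝ ∞ ν, ‖h‖ ≤ 1 → (∀ᵐ ω ∂ν, ω ∉ E' → h ω = 0) → ‖A h‖ ≤ δ := by
  obtain ⟨E₀, hE₀E, hE₀, hE₀0, hE₀δ⟩ := exists_subset_measure_le (h δ hδ) hE hE0
  have hsplit : ∀ S : {S : Set Ω // MeasurableSet S ∧ 0 < ν S},
      ∃ S' : {S : Set Ω // MeasurableSet S ∧ 0 < ν S}, S'.1 ⊆ S.1 ∧ ν S'.1 < ν S.1 := by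
    rintro ⟨S, hS, hS0⟩
    have h0 : 0 < (ν S).toReal := ENNReal.toReal_pos hS0.ne' (measure_ne_top _ _)
    obtain ⟨S', hS'S, hS', hS'0, hS'δ⟩ := exists_subset_measure_le (h _ (half_pos h0)) hS hS0
    refine ⟨⟨S', hS', hS'0⟩, hS'S, hS'δ.trans_lt ?_⟩
    rw [ENNReal.ofReal_lt_iff_lt_toReal (by positivity) (measure_ne_top _ _)]
    linarith
  choose next hnext hnext' using hsplit
  -- A decreasing chain with strictly decreasing measures; its successive differences are disjoint
  -- sets of positive measure inside `E₀`, and `A` is small on one of them.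
  set S : ℕ → {S : Set Ω // MeasurableSet S ∧ 0 < ν S} := fun j => next^[j] ⟨E₀, hE₀, hE₀0⟩
    with hSdef
  have hSsucc : ∀ j, S (j + 1) = next (S j) := fun j => Function.iterate_succ_apply' _ _ _
  have hanti : Antitone fun j => (S j).1 := antitone_nat_of_succ_le fun j => by
    rw [hSsucc]; exact hnext _
  obtain ⟨j, hj⟩ := exists_norm_map_le_of_disjoint A (fun j => (S j).1 \ (S (j + 1)).1) (by
    intro i j hij
    wlog hlt : i < j generalizing i j
    · exact (this hij.symm (lt_of_le_of_ne (not_lt.1 hlt) hij.symm)).symm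
    exact Set.disjoint_left.2 fun x hx hx' => hx.2 (hanti hlt hx'.1)) hδ
  have hsub : (S j).1 \ (S (j + 1)).1 ⊆ E₀ := fun x hx => hanti (Nat.zero_le j) hx.1
  refine ⟨_, hsub.trans hE₀E, (S j).2.1.diff (S (j + 1)).2.1, ?_,
    (measure_mono hsub).trans hE₀δ, hj⟩
  refine lt_of_lt_of_le ?_ le_measure_sdiff
  rw [tsub_pos_iff_lt, hSsucc]
  exact hnext' _

/-- In an atomless space there is a filter with arbitrarily small members on which a given bounded
operator is arbitrarily small. -/
theorem exists_isMeasureFilter_norm_map_le (A : POperator ν)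
    (h : ∀ δ : ℝ, 0 < δ → ∃ D : ℤ → Set Ω, (∀ j, MeasurableSet (D j)) ∧ ⋃ j, D j = Set.univ ∧
      ∀ j, ν (D j) ≤ ENNReal.ofReal δ) :
    ∃ F : Set (Set Ω), IsMeasureFilter ν F ∧ ∀ δ : ℝ, 0 < δ → ∃ S ∈ F, ν S ≤ ENNReal.ofReal δ ∧
      ∀ h : Lp ℝ ∞ ν, ‖h‖ ≤ 1 → (∀ᵐ ω ∂ν, ω ∉ S → h ω = 0) → ‖A h‖ ≤ δ := by
  have hstep : ∀ (j : ℕ) (S : {S : Set Ω // MeasurableSet S ∧ 0 < ν S}),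
      ∃ S' : {S : Set Ω // MeasurableSet S ∧ 0 < ν S}, S'.1 ⊆ S.1 ∧
        ν S'.1 ≤ ENNReal.ofReal (1 / ((j : ℝ) + 1)) ∧
        ∀ h : Lp ℝ ∞ ν, ‖h‖ ≤ 1 → (∀ᵐ ω ∂ν, ω ∉ S'.1 → h ω = 0) → ‖A h‖ ≤ 1 / ((j : ℝ) + 1) := by
    rintro j ⟨S, hS, hS0⟩
    obtain ⟨S', h1, h2, h3, h4, h5⟩ := exists_subset_measure_le_norm_map_le A h
      (show (0 : ℝ) < 1 / ((j : ℝ) + 1) by positivity) hS hS0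
    exact ⟨⟨S', h2, h3⟩, h1, h4, h5⟩
  choose next hnext hnu hsmall using hstep
  set S : ℕ → {S : Set Ω // MeasurableSet S ∧ 0 < ν S} := fun j =>
    Nat.rec ⟨Set.univ, MeasurableSet.univ, by simp⟩ (fun j T => next j T) j
  have hSsucc : ∀ j, S (j + 1) = next j (S j) := fun j => rfl
  have hanti : Antitone fun j => (S j).1 := antitone_nat_of_succ_le fun j => hnext j _
  -- The filter generated by the nested sets `S j`: nesting gives closure under intersection, and
  -- positivity is needed only for each single `S j`.
  refine ⟨{T | MeasurableSet T ∧ ∃ j, (S j).1 ⊆ T}, ⟨?_, ?_, ?_, ?_, ?_⟩, fun δ hδ => ?_⟩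
  · exact ⟨Set.univ, MeasurableSet.univ, 0, Set.subset_univ _⟩
  · exact fun T hT => hT.1
  · rintro T ⟨-, j, hj⟩
    exact (S j).2.2.trans_le (measure_mono hj)
  · rintro T ⟨hT, i, hi⟩ T' ⟨hT', j, hj⟩
    exact ⟨hT.inter hT', max i j, Set.subset_inter ((hanti (le_max_left i j)).trans hi)
      ((hanti (le_max_right i j)).trans hj)⟩
  · rintro T ⟨-, j, hj⟩ T' hT' hTT'
    exact ⟨hT', j, hj.trans hTT'⟩
  · obtain ⟨j, hj⟩ := exists_nat_one_div_lt hδ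
    refine ⟨(S (j + 1)).1, ⟨(S (j + 1)).2.1, j + 1, subset_rfl⟩,
      (hnu j _).trans (ENNReal.ofReal_le_ofReal hj.le), fun h h1 h2 => ?_⟩
    exact (hsmall j _ h h1 h2).trans hj.le

end atomless

/-! ### The functional of an ultrafilter and prescribing its values. -/

section ultrafilter

variable {Ω : Type*} {m : MeasurableSpace Ω} {ν : Measure Ω} {U : Set (Set Ω)}

/-- By uniqueness `φ_U` is the limit along `U`, so its values can be read off at a point of a
suitable member of `U`. -/
theorem ultrafilterFunctional_mem (hU : Maximal (IsMeasureFilter ν) U) (f : Lp ℝ ∞ ν) {ε : ℝ}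
    (hε : 0 < ε) : {ω | |f ω - ultrafilterFunctional hU f| < ε} ∈ U := by
  obtain ⟨φ, hφ⟩ := IsMeasureFilter.exists_functional hU
  have h : φ = ultrafilterFunctional hU :=
    (IsMeasureFilter.existsUnique_functional hU).unique
      (IsMeasureFilter.isFilterFunctional_of_forall hU hφ) (ultrafilterFunctional_spec hU)
  rw [← h]
  exact hφ f ε hε

/-- Up to a null set `{f = c}` contains `S`, so it meets every member of `U` in positive measure and
belongs to `U` by maximality. -/
theorem ultrafilterFunctional_eq_of_mem (hU : Maximal (IsMeasureFilter ν) U) (f : Lp ℝ ∞ ν)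
    {c : ℝ} {S : Set Ω} (hS : S ∈ U) (h : ∀ᵐ ω ∂ν, ω ∈ S → f ω = c) :
    ultrafilterFunctional hU f = c := by
  refine eq_of_forall_dist_le fun ε hε => ?_
  have h1 : {ω | f ω = c} ∈ U := by
    refine IsMeasureFilter.mem_of_forall_pos hU
      (measurableSet_eq_fun (IsMeasureFilter.measurable_coe f) measurable_const) fun T hT => ?_
    refine (hU.prop.pos _ (hU.prop.inter _ hT _ hS)).trans_le (measure_mono_ae ?_)
    filter_upwards [h] with ω hω hω'
    exact ⟨hω'.1, hω hω'.2⟩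
  obtain ⟨ω, h2, h3⟩ := IsMeasureFilter.nonempty_of_mem hU
    (hU.prop.inter _ h1 _ (ultrafilterFunctional_mem hU f hε))
  simp only [Set.mem_ofPred_eq] at h2 h3
  rw [h2, abs_sub_comm] at h3
  exact h3.le

theorem le_ultrafilterFunctional (hU : Maximal (IsMeasureFilter ν) U) (f : Lp ℝ ∞ ν)
    {c : ℝ} (h : ∀ᵐ ω ∂ν, c ≤ f ω) : c ≤ ultrafilterFunctional hU f := by
  refine le_of_forall_pos_le_add fun ε hε => ?_
  have h1 : {ω | c ≤ f ω} ∈ U := IsMeasureFilter.mem_of_ae hU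
    (measurableSet_le measurable_const (IsMeasureFilter.measurable_coe f)) h
  obtain ⟨ω, h2, h3⟩ := IsMeasureFilter.nonempty_of_mem hU
    (hU.prop.inter _ h1 _ (ultrafilterFunctional_mem hU f hε))
  simp only [Set.mem_ofPred_eq] at h2 h3
  rw [abs_lt] at h3
  linarith

theorem abs_ultrafilterFunctional_le (hU : Maximal (IsMeasureFilter ν) U) (f : Lp ℝ ∞ ν) :
    |ultrafilterFunctional hU f| ≤ ‖f‖ := by
  have h : ∀ f : Lp ℝ ∞ ν, -‖f‖ ≤ ultrafilterFunctional hU f := fun f => by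
    refine le_ultrafilterFunctional hU f ?_
    filter_upwards [IsMeasureFilter.ae_abs_le_norm f] with ω hω
    exact (abs_le.1 hω).1
  refine abs_le.2 ⟨h f, ?_⟩
  have := h (-f)
  rw [norm_neg, map_neg] at this
  linarith

theorem ultrafilterFunctional_const [IsProbabilityMeasure ν] (hU : Maximal (IsMeasureFilter ν) U)
    (c : ℝ) : ultrafilterFunctional hU (Lp.const ∞ ν c) = c := by
  refine ultrafilterFunctional_eq_of_mem hU _ (IsMeasureFilter.univ_mem hU) ?_
  exact (Lp.coeFn_const (p := ∞) (μ := ν) c).mono fun ω hω _ => hω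

theorem exists_isMeasureFilter_maximal {F : Set (Set Ω)} (hF : IsMeasureFilter ν F) :
    ∃ U, F ⊆ U ∧ Maximal (IsMeasureFilter ν) U := by
  refine zorn_subset_nonempty {F | IsMeasureFilter ν F} (fun c hc hchain hne => ?_) F hF
  refine ⟨⋃₀ c, ⟨?_, ?_, ?_, ?_, ?_⟩, fun s hs => Set.subset_sUnion_of_mem hs⟩
  · obtain ⟨G, hG⟩ := hne
    obtain ⟨S, hS⟩ := (hc hG).nonempty
    exact ⟨S, G, hG, hS⟩
  · rintro S ⟨G, hG, hS⟩
    exact (hc hG).measurableSet S hS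
  · rintro S ⟨G, hG, hS⟩
    exact (hc hG).pos S hS
  · rintro S ⟨G, hG, hS⟩ T ⟨H, hH, hT⟩
    rcases hchain.total hG hH with h | h
    · exact ⟨H, hH, (hc hH).inter S (h hS) T hT⟩
    · exact ⟨G, hG, (hc hG).inter S hS T (h hT)⟩
  · rintro S ⟨G, hG, hS⟩ T hT hST
    exact ⟨G, hG, (hc hG).superset S hS T hT hST⟩

/-- Functions in the unit ball can be changed so as to have prescribed values under `φ_U`, with little
effect on the joint law of the functions and their images. -/
theorem exists_ultrafilterFunctional_eq_edist_le [IsProbabilityMeasure ν]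
    (hU : Maximal (IsMeasureFilter ν) U) (A : POperator ν)
    (hsmall : ∀ δ : ℝ, 0 < δ → ∃ S ∈ U, ν S ≤ ENNReal.ofReal δ ∧
      ∀ h : Lp ℝ ∞ ν, ‖h‖ ≤ 1 → (∀ᵐ ω ∂ν, ω ∉ S → h ω = 0) → ‖A h‖ ≤ δ)
    {k : ℕ} (g : Fin k → Lp ℝ ∞ ν) (c : Fin k → ℝ) (hg : ∀ i, ‖g i‖ ≤ 1) (hc : ∀ i, |c i| ≤ 1)
    {δ : ℝ} (hδ : 0 < δ) :
    ∃ g' : Fin k → Lp ℝ ∞ ν, (∀ i, ‖g' i‖ ≤ 1) ∧ (∀ i, ultrafilterFunctional hU (g' i) = c i) ∧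
      edist (LevyProkhorov.ofMeasure (jointLaw A g)) (LevyProkhorov.ofMeasure (jointLaw A g')) ≤
        ENNReal.ofReal δ := by
  classical
  -- An error `r` in each of the `2k` coordinates keeps the distance below `δ`; the `+ 1` covers `k
  -- = 0`. Next, `η` solves `η + k (2η/r) = δ`: the measure of `S` plus `k` Markov bounds.
  set r : ℝ := δ / (2 * k + 1)
  have hr : 0 < r := by positivity
  set η : ℝ := δ / (1 + k * (2 / r))
  have hη : 0 < η := by positivity
  obtain ⟨S, hS, hSη, hSA⟩ := hsmall η hη
  have hSm := hU.prop.measurableSet S hS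
  have hbd : ∀ i, ∀ᵐ ω ∂ν, ‖S.piecewise (fun _ => c i) (g i) ω‖ ≤ 1 := fun i => by
    filter_upwards [IsMeasureFilter.ae_abs_le_norm (g i)] with ω hω
    by_cases h : ω ∈ S
    · rw [Set.piecewise_eq_of_mem _ _ _ h]
      exact hc i
    · rw [Set.piecewise_eq_of_notMem _ _ _ h]
      exact hω.trans (hg i)
  have hmem : ∀ i, MemLp (S.piecewise (fun _ => c i) (g i)) ∞ ν := fun i =>
    MemLp.of_bound (Measurable.piecewise hSm measurable_const
      (IsMeasureFilter.measurable_coe (g i))).aestronglyMeasurable 1 (hbd i)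
  set g' : Fin k → Lp ℝ ∞ ν := fun i => (hmem i).toLp
  have hg'S : ∀ i, ∀ᵐ ω ∂ν, g' i ω = S.piecewise (fun _ => c i) (g i) ω := fun i =>
    (hmem i).coeFn_toLp
  have hg' : ∀ i, ‖g' i‖ ≤ 1 := fun i => norm_le_of_ae_abs_le _ zero_le_one (by
    filter_upwards [hbd i, hg'S i] with ω h1 h2
    rwa [h2])
  refine ⟨g', hg', fun i => ?_, ?_⟩
  · refine ultrafilterFunctional_eq_of_mem hU _ hS ?_
    filter_upwards [hg'S i] with ω h1 h2
    rw [h1, Set.piecewise_eq_of_mem _ _ _ h2]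
  · refine edist_jointLaw_le_of_measure_dist_le A A g g' hδ.le ?_
    have hA : ∀ i, ‖A (g i) - A (g' i)‖ ≤ 2 * η := by
      intro i
      -- The difference has norm at most 2 and is supported in `S`; halving it makes the smallness
      -- of `A` on `S` applicable.
      have h1 : ‖A ((2⁻¹ : ℝ) • (g i - g' i))‖ ≤ η := by
        refine hSA _ ?_ ?_
        · rw [norm_smul, Real.norm_of_nonneg (by positivity)]
          have := (norm_sub_le (g i) (g' i)).trans (add_le_add (hg i) (hg' i))
          linarith
        · filter_upwards [Lp.coeFn_smul (2⁻¹ : ℝ) (g i - g' i), Lp.coeFn_sub (g i) (g' i), hg'S i]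
            with ω h1 h2 h3 h4
          rw [h1, Pi.smul_apply, h2, Pi.sub_apply, h3, Set.piecewise_eq_of_notMem _ _ _ h4]
          simp
      rw [map_smul, norm_smul, map_sub, Real.norm_of_nonneg (by positivity)] at h1
      linarith
    have hmarkov : ∀ i, ν {ω | r ≤ |(A (g i) - A (g' i)) ω|} ≤ ENNReal.ofReal (2 * η / r) := by
      intro i
      have h1 := mul_meas_ge_le_integral_of_nonneg (μ := ν)
        (f := fun ω => |(A (g i) - A (g' i)) ω|) (Eventually.of_forall fun _ => abs_nonneg _)
        (L1.integrable_coeFn _).abs r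
      have h2 : ∫ ω, |(A (g i) - A (g' i)) ω| ∂ν ≤ 2 * η := by
        refine le_trans (le_of_eq ?_) (hA i)
        rw [L1.norm_eq_integral_norm]
        rfl
      rw [← ENNReal.ofReal_toReal (measure_ne_top ν {ω | r ≤ |(A (g i) - A (g' i)) ω|})]
      refine ENNReal.ofReal_le_ofReal ?_
      rw [le_div_iff₀' hr]
      exact h1.trans h2
    have hsub : {ω | ¬ dist (jointMap A g ω) (jointMap A g' ω) ≤ δ} ≤ᵐ[ν]
        (S ∪ ⋃ i, {ω | r ≤ |(A (g i) - A (g' i)) ω|} : Set Ω) := by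
      filter_upwards [ae_all_iff.2 hg'S, ae_all_iff.2 fun i => Lp.coeFn_sub (A (g i)) (A (g' i))]
        with ω h1 h2 h3
      by_contra! h4
      change ω ∉ S ∪ ⋃ i, {ω | r ≤ |(A (g i) - A (g' i)) ω|} at h4
      simp only [Set.mem_union, Set.mem_iUnion, Set.mem_ofPred_eq, not_or, not_exists,
        not_le] at h4
      refine h3 ((dist_euclidean_le _ _ hr.le ?_).trans ?_)
      · rintro (i | i)
        · rw [jointMap_inl, jointMap_inl, h1 i, Set.piecewise_eq_of_notMem _ _ _ h4.1, sub_self,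
            abs_zero]
          exact hr.le
        · have := h4.2 i
          rw [h2 i] at this
          exact this.le
      · rw [Fintype.card_sum, Fintype.card_fin, mul_div, div_le_iff₀ (by positivity)]
        push_cast
        nlinarith
    refine (measure_mono_ae hsub).trans ((measure_union_le _ _).trans
      ((add_le_add hSη (measure_iUnion_fintype_le _ _)).trans ?_))
    refine (add_le_add le_rfl (Finset.sum_le_sum fun i _ => hmarkov i)).trans ?_
    rw [Finset.sum_const, Finset.card_univ, Fintype.card_fin, ← ENNReal.ofReal_nsmul,
      ← ENNReal.ofReal_add hη.le (by positivity)]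
    refine ENNReal.ofReal_le_ofReal (le_of_eq ?_)
    have h1 : η * (1 + k * (2 / r)) = δ := div_mul_cancel₀ _ (by positivity)
    rw [← h1, nsmul_eq_mul]
    ring

end ultrafilter

/-! ### Action limits of `G⁺` and failure of self-adjointness. -/

section universalVertex

theorem minusOperator_eq_addFunctional {Ω : Type*} {m : MeasurableSpace Ω} {ν : Measure Ω}
    [IsProbabilityMeasure ν] (A : POperator ν) {U : Set (Set Ω)}
    (hU : Maximal (IsMeasureFilter ν) U) :
    minusOperator A hU = addFunctional A (-ultrafilterFunctional hU) := by
  ext1 f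
  simp [minusOperator, addFunctional, sub_eq_add_neg]

theorem actionConverges_addUniversalVertex {V : ℕ → Type*} [∀ n, Fintype (V n)]
    [∀ n, Nonempty (V n)] {G : ∀ n, SimpleGraph (V n)} {Ω : Type*} {m : MeasurableSpace Ω}
    {ν : Measure Ω} [IsProbabilityMeasure ν] {A : POperator ν}
    (hV : Tendsto (fun n => Fintype.card (V n)) atTop atTop)
    (hA : ActionConverges (fun n => adjacencyOperator (G n)) A)
    {U : Set (Set Ω)} (hU : Maximal (IsMeasureFilter ν) U)
    (hsmall : ∀ δ : ℝ, 0 < δ → ∃ S ∈ U, ν S ≤ ENNReal.ofReal δ ∧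
      ∀ h : Lp ℝ ∞ ν, ‖h‖ ≤ 1 → (∀ᵐ ω ∂ν, ω ∉ S → h ω = 0) → ‖A h‖ ≤ δ) :
    ActionConverges (fun n => adjacencyOperator (G n).addUniversalVertex) (plusOperator A hU) ∧
    ActionConverges (fun n => adjacencyOperator (G n).addUniversalVertex) (minusOperator A hU) := by
  have hinv : Tendsto (fun n => (Fintype.card (V n) : ℝ≥0∞)⁻¹) atTop (𝓝 0) :=
    ENNReal.tendsto_inv_nat_nhds_zero.comp hV
  have hlim : Tendsto (fun n => (Fintype.card (V n) : ℝ≥0∞)⁻¹ +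
      actionDist (adjacencyOperator (G n)) A) atTop (𝓝 0) := by
    simpa using hinv.add hA
  have key : ∀ ψ : Lp ℝ ∞ ν →L[ℝ] ℝ,
      (ψ = ultrafilterFunctional hU ∨ ψ = -ultrafilterFunctional hU) →
      ActionConverges (fun n => adjacencyOperator (G n).addUniversalVertex)
        (addFunctional A ψ) := by
    intro ψ hψ
    refine tendsto_of_tendsto_of_tendsto_of_le_of_le tendsto_const_nhds hlim (fun _ => bot_le)
      fun n => actionDist_le_add_of_forall fun k => ?_
    refine hausdorffEDist_kProfile_addUniversalVertex_le (G n) A ψ (fun f hf => ?_) k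
      fun g c hg hc δ hδ => ?_
    · have := (abs_ultrafilterFunctional_le hU f).trans hf
      rcases hψ with rfl | rfl
      · exact this
      · simpa using this
    · rcases hψ with rfl | rfl
      · exact exists_ultrafilterFunctional_eq_edist_le hU A hsmall g c hg hc hδ
      -- Prescribing `-c` for `φ_U` prescribes `c` for `-φ_U`.
      · obtain ⟨g', h1, h2, h3⟩ := exists_ultrafilterFunctional_eq_edist_le hU A hsmall g
          (fun i => -c i) hg (by simpa using hc) hδ
        exact ⟨g', h1, fun i => by simp [h2], h3⟩
  refine ⟨key _ (Or.inl rfl), ?_⟩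
  rw [minusOperator_eq_addFunctional]
  exact key _ (Or.inr rfl)

/-- The indicator of the new vertex is 0 at every old vertex while its image there is 1; the
1-profile transfers this to `B`. -/
theorem ActionConverges.exists_near_zero_map_near_one {V : ℕ → Type*} [∀ n, Fintype (V n)]
    [∀ n, Nonempty (V n)] {G : ∀ n, SimpleGraph (V n)} {Ω : Type*} {m : MeasurableSpace Ω}
    {ν : Measure Ω} [IsProbabilityMeasure ν] {B : POperator ν}
    (hV : Tendsto (fun n => Fintype.card (V n)) atTop atTop)
    (hB : ActionConverges (fun n => adjacencyOperator (G n).addUniversalVertex) B)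
    {δ : ℝ} (hδ : 0 < δ) :
    ∃ g : Lp ℝ ∞ ν, ‖g‖ ≤ 1 ∧ ν {ω | δ ≤ |g ω| ∨ δ ≤ |B g ω - 1|} ≤ ENNReal.ofReal δ := by
  set r := δ / 2 with hr
  have hrpos : 0 < r := by positivity
  have hinv : Tendsto (fun n => (Fintype.card (V n) : ℝ≥0∞)⁻¹) atTop (𝓝 0) :=
    ENNReal.tendsto_inv_nat_nhds_zero.comp hV
  obtain ⟨n, hn1, hn2⟩ := ((hB.tendsto_hausdorffEDist 0).eventually_lt_const
    (ENNReal.ofReal_pos.2 hrpos) |>.and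
      (hinv.eventually_lt_const (ENNReal.ofReal_pos.2 hrpos))).exists
  set f : Fin 1 → Lp ℝ ∞ (uniformMeasure (Option (V n))) := fun _ =>
    uniformToLp fun x => x.elim 1 fun _ => 0
  have hf : ∀ i, ‖f i‖ ≤ 1 := fun i => norm_uniformToLp_le fun x => by cases x <;> simp
  obtain ⟨_, ⟨g, hg, rfl⟩, hfg⟩ := Metric.exists_edist_lt_of_hausdorffEDist_lt
    (jointLaw_mem_kProfile (adjacencyOperator (G n).addUniversalVertex) hf) hn1
  rw [edist_comm] at hfg
  refine ⟨g 0, hg 0, ?_⟩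
  set T : Set (EuclideanSpace ℝ (Fin (0 + 1) ⊕ Fin (0 + 1))) :=
    {y | δ ≤ |y (Sum.inl 0)| ∨ δ ≤ |y (Sum.inr 0) - 1|} with hT
  have hTm : MeasurableSet T := by
    have hinl : MeasurableSet {y : EuclideanSpace ℝ (Fin (0 + 1) ⊕ Fin (0 + 1)) |
        δ ≤ |y (Sum.inl 0)|} := by
      refine measurableSet_le measurable_const ?_
      exact ((measurable_pi_apply _).comp (WithLp.measurable_ofLp 2 _)).norm
    have hinr : MeasurableSet {y : EuclideanSpace ℝ (Fin (0 + 1) ⊕ Fin (0 + 1)) |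
        δ ≤ |y (Sum.inr 0) - 1|} := by
      refine measurableSet_le measurable_const ?_
      exact (((measurable_pi_apply _).comp (WithLp.measurable_ofLp 2 _)).sub_const 1).norm
    exact hinl.union hinr
  have h1 := levyProkhorov_le_of_edist_lt hfg hTm
  rw [jointLaw_apply B g hTm, ENNReal.toReal_ofReal hrpos.le,
    jointLaw_apply _ f Metric.isOpen_thickening.measurableSet] at h1
  -- Old vertices map to `(0, 1)`, which is at distance at least `δ > r` from `T`.
  have h2 : some ⁻¹' (jointMap (adjacencyOperator (G n).addUniversalVertex) f ⁻¹'
      Metric.thickening r T) = ∅ := by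
    refine Set.eq_empty_of_forall_notMem fun x hx => ?_
    obtain ⟨y, hy, hxy⟩ := Metric.mem_thickening_iff.1 hx
    have h3 := (abs_apply_le_dist _ _ (Sum.inl 0)).trans_lt hxy
    have h4 := (abs_apply_le_dist _ _ (Sum.inr 0)).trans_lt hxy
    have hfx : (f 0 : Option (V n) → ℝ) = fun x => x.elim 1 fun _ => 0 :=
      funext (uniformToLp_coeFn _)
    rw [jointMap_inl, hfx] at h3
    rw [jointMap_inr, adjacencyOperator_coeFn, adjacencyFun_addUniversalVertex_some, hfx] at h4
    simp only [Option.elim_some, Option.elim_none, adjacencyFun, ite_self,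
      Finset.sum_const_zero, zero_add, zero_sub, abs_neg] at h3 h4
    rw [abs_sub_comm] at h4
    rcases hy with hy | hy <;> linarith
  refine h1.trans ((add_le_add ((uniformMeasure_option_le _).trans ?_) le_rfl).trans_eq
    (b := ENNReal.ofReal r + ENNReal.ofReal r) ?_)
  · rw [h2, measure_empty, zero_add]
    exact hn2.le
  · rw [← ENNReal.ofReal_add hrpos.le hrpos.le, hr, add_halves]

/-- No action limit of the graphs `G⁺` is self-adjoint. -/
theorem ActionConverges.not_isSelfAdjointOp {V : ℕ → Type*} [∀ n, Fintype (V n)]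
    [∀ n, Nonempty (V n)] {G : ∀ n, SimpleGraph (V n)} {Ω : Type*} {m : MeasurableSpace Ω}
    {ν : Measure Ω} [IsProbabilityMeasure ν] {B : POperator ν}
    (hV : Tendsto (fun n => Fintype.card (V n)) atTop atTop)
    (hB : ActionConverges (fun n => adjacencyOperator (G n).addUniversalVertex) B) :
    ¬ IsSelfAdjointOp B := by
  intro hself
  -- These bounds sum to `1/2`: finite, as Borel–Cantelli needs, and small enough that the
  -- complement `E` of all exceptional sets has measure at least `1/2`.
  have hδ : ∀ j : ℕ, (0 : ℝ) < (1 / 2) ^ (j + 1) / 2 := fun j => by positivity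
  choose g hg hgν using fun j => hB.exists_near_zero_map_near_one hV (hδ j)
  set N : ℕ → Set Ω := fun j =>
    {ω | (1 / 2) ^ (j + 1) / 2 ≤ |g j ω| ∨ (1 / 2) ^ (j + 1) / 2 ≤ |B (g j) ω - 1|} with hN
  have hNm : ∀ j, MeasurableSet (N j) := fun j =>
    MeasurableSet.union
      (measurableSet_le measurable_const (IsMeasureFilter.measurable_coe (g j)).norm)
      (measurableSet_le measurable_const
        ((Lp.stronglyMeasurable (B (g j))).measurable.sub_const 1).norm)
  have hsum : ∑' j, ν (N j) ≤ 1 / 2 := by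
    refine (ENNReal.tsum_le_tsum hgν).trans_eq ?_
    have h1 : ∀ j : ℕ, ENNReal.ofReal ((1 / 2) ^ (j + 1) / 2) = (1 / 2) * (1 / 2 ^ (j + 1)) := by
      intro j
      rw [div_pow, one_pow, ENNReal.ofReal_div_of_pos two_pos,
        ENNReal.ofReal_div_of_pos (by positivity), ENNReal.ofReal_pow zero_le_two]
      simp [div_eq_mul_inv, mul_comm]
    simp only [h1]
    rw [ENNReal.tsum_mul_left, tsum_two_pow_inv, mul_one]
  have hsum' : ∑' j, ν (N j) ≠ ∞ := (hsum.trans_lt (by simp)).ne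
  set E : Set Ω := (⋃ j, N j)ᶜ
  have hEm : MeasurableSet E := (MeasurableSet.iUnion hNm).compl
  have hE : 1 / 2 ≤ ν E := by
    rw [prob_compl_eq_one_sub (MeasurableSet.iUnion hNm)]
    refine ENNReal.le_sub_of_add_le_left (measure_ne_top _ _) ?_
    refine (add_le_add ((measure_iUnion_le N).trans hsum) le_rfl).trans_eq ?_
    exact ENNReal.add_halves 1
  have hE' : 1 / 2 ≤ ν.real E := by
    have := ENNReal.toReal_mono (measure_ne_top ν E) hE
    simpa [measureReal_def] using this
  set h : Lp ℝ ∞ ν := indicatorConstLp ∞ hEm (measure_ne_top ν E) (1 : ℝ)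
  have hh : ∀ᵐ ω ∂ν, h ω = E.indicator (fun _ => 1) ω := indicatorConstLp_coeFn
  -- On `E` one has `B (g j) ≥ 3/4`, and `ν E ≥ 1/2`.
  have hlow : ∀ j, 3 / 8 ≤ ∫ ω, B (g j) ω * h ω ∂ν := by
    intro j
    have h1 : ∫ ω, B (g j) ω * h ω ∂ν = ∫ ω in E, B (g j) ω ∂ν := by
      rw [← integral_indicator hEm]
      refine integral_congr_ae ?_
      filter_upwards [hh] with ω hω
      rw [hω]
      by_cases hωE : ω ∈ E <;> simp [hωE]
    have h2 : ∫ _ω in E, (3 / 4 : ℝ) ∂ν ≤ ∫ ω in E, B (g j) ω ∂ν := by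
      refine setIntegral_mono_on (integrable_const _) (L1.integrable_coeFn _).integrableOn hEm
        fun ω hω => ?_
      have h3 : ω ∉ N j := fun h => hω (Set.mem_iUnion.2 ⟨j, h⟩)
      rw [hN, Set.mem_ofPred_eq, not_or, not_le, not_le] at h3
      have h5 := (abs_lt.1 h3.2).1
      have h4 : ((1 : ℝ) / 2) ^ (j + 1) ≤ 1 / 2 := by
        rw [pow_succ]
        have : ((1 : ℝ) / 2) ^ j ≤ 1 := pow_le_one₀ (by norm_num) (by norm_num)
        linarith
      linarith
    rw [h1]
    refine le_trans ?_ h2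
    rw [setIntegral_const, smul_eq_mul]
    linarith
  have hlim : Tendsto (fun j => ∫ ω, B h ω * g j ω ∂ν) atTop (𝓝 (∫ _ω, (0 : ℝ) ∂ν)) := by
    refine tendsto_integral_of_dominated_convergence (fun ω => |B h ω|) (fun j => ?_)
      (L1.integrable_coeFn _).abs (fun j => ?_) ?_
    · exact (Lp.aestronglyMeasurable _).mul (Lp.aestronglyMeasurable _)
    · filter_upwards [IsMeasureFilter.ae_abs_le_norm (g j)] with ω hω
      rw [norm_mul]
      exact mul_le_of_le_one_right (norm_nonneg _) (hω.trans (hg j))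
    · filter_upwards [ae_eventually_notMem hsum'] with ω hω
      have h0 : Tendsto (fun j : ℕ => ((1 : ℝ) / 2) ^ (j + 1) / 2) atTop (𝓝 0) := by
        have := ((tendsto_pow_atTop_nhds_zero_of_lt_one (r := (1 : ℝ) / 2) (by norm_num)
          (by norm_num)).comp (tendsto_add_atTop_nat 1)).div_const 2
        simpa using this
      have h1 : Tendsto (fun j => g j ω) atTop (𝓝 0) := by
        refine squeeze_zero_norm' ?_ h0
        filter_upwards [hω] with j hj
        rw [hN, Set.mem_ofPred_eq, not_or, not_le] at hj
        exact hj.1.le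
      simpa using h1.const_mul (B h ω)
  rw [integral_zero] at hlim
  have h1 := ge_of_tendsto' hlim fun j => (hlow j).trans_eq (hself (g j) h)
  norm_num at h1

end universalVertex

/-! ### Regularity and positivity of `A⁺` and `A⁻`. -/

section regular

variable {Ω : Type*} {m : MeasurableSpace Ω} {ν : Measure Ω} [IsProbabilityMeasure ν]
  {U : Set (Set Ω)}

theorem smul_const_injective :
    Function.Injective fun c : ℝ => c • Lp.const 1 ν (1 : ℝ) := by
  refine smul_left_injective ℝ fun h => ?_
  have h1 := Lp.norm_const 1 ν (1 : ℝ)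
  rw [h] at h1
  simp at h1

theorem plusOperator_apply (A : POperator ν) (hU : Maximal (IsMeasureFilter ν) U)
    (f : Lp ℝ ∞ ν) :
    plusOperator A hU f = A f + ultrafilterFunctional hU f • Lp.const 1 ν (1 : ℝ) := rfl

theorem minusOperator_apply (A : POperator ν) (hU : Maximal (IsMeasureFilter ν) U)
    (f : Lp ℝ ∞ ν) :
    minusOperator A hU f = A f - ultrafilterFunctional hU f • Lp.const 1 ν (1 : ℝ) := rfl

theorem plusOperator_ne_minusOperator (A : POperator ν) (hU : Maximal (IsMeasureFilter ν) U) :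
    plusOperator A hU ≠ minusOperator A hU := by
  intro h
  have h1 := DFunLike.congr_fun h (Lp.const ∞ ν (1 : ℝ))
  rw [plusOperator_apply, minusOperator_apply, sub_eq_add_neg, add_right_inj, ← neg_smul,
    ultrafilterFunctional_const] at h1
  have := smul_const_injective h1
  norm_num at this

theorem IsRegularOp.plusOperator {A : POperator ν} {c : ℝ} (h : IsRegularOp c A)
    (hU : Maximal (IsMeasureFilter ν) U) : IsRegularOp (c + 1) (plusOperator A hU) := by
  rw [IsRegularOp, plusOperator_apply, h, ultrafilterFunctional_const, add_smul]

theorem IsRegularOp.minusOperator {A : POperator ν} {c : ℝ} (h : IsRegularOp c A)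
    (hU : Maximal (IsMeasureFilter ν) U) : IsRegularOp (c - 1) (minusOperator A hU) := by
  rw [IsRegularOp, minusOperator_apply, h, ultrafilterFunctional_const, sub_smul]

theorem isRegularOp_zero : IsRegularOp 0 (0 : POperator ν) := by
  simp [IsRegularOp]

theorem IsRegularOp.eq {A : POperator ν} {c d : ℝ} (hc : IsRegularOp c A) (hd : IsRegularOp d A) :
    c = d :=
  smul_const_injective (hc.symm.trans hd)

theorem isPositivityPreserving_plusOperator_zero (hU : Maximal (IsMeasureFilter ν) U) :
    IsPositivityPreserving (plusOperator 0 hU) := by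
  intro f hf
  filter_upwards [addFunctional_coeFn 0 (ultrafilterFunctional hU) f, Lp.coeFn_zero ℝ 1 ν]
    with ω h1 h2
  refine (le_ultrafilterFunctional hU f hf).trans_eq (Eq.trans ?_ h1.symm)
  change _ = (0 : Lp ℝ 1 ν) ω + _
  rw [h2, Pi.zero_apply, zero_add]

theorem not_isPositivityPreserving_minusOperator_zero (hU : Maximal (IsMeasureFilter ν) U) :
    ¬ IsPositivityPreserving (minusOperator 0 hU) := by
  intro h
  have h1 := h (Lp.const ∞ ν (1 : ℝ)) (by
    filter_upwards [Lp.coeFn_const (p := ∞) (μ := ν) (1 : ℝ)] with ω hω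
    rw [hω]
    exact zero_le_one)
  rw [minusOperator_eq_addFunctional] at h1
  have h2 : ∀ᵐ _ω ∂ν, False := by
    filter_upwards [h1, addFunctional_coeFn 0 (-ultrafilterFunctional hU) (Lp.const ∞ ν (1 : ℝ)),
      Lp.coeFn_zero ℝ 1 ν] with ω h3 h4 h5
    rw [h4] at h3
    change 0 ≤ (0 : Lp ℝ 1 ν) ω + -ultrafilterFunctional hU (Lp.const ∞ ν (1 : ℝ)) at h3
    rw [h5, ultrafilterFunctional_const] at h3
    norm_num at h3
  exact h2.exists.elim fun _ h => h

end regular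

/-! ### Edgeless graphs converge to the zero operator. -/

section edgeless

theorem adjacencyOperator_bot_coeFn {V : Type*} [Fintype V] [Nonempty V]
    (f : Lp ℝ ∞ (uniformMeasure V)) (x : V) :
    adjacencyOperator (⊥ : SimpleGraph V) f x = 0 := by
  simp [adjacencyOperator_coeFn, adjacencyFun]

theorem zero_pOperator_coeFn {Ω : Type*} {m : MeasurableSpace Ω} {ν : Measure Ω}
    (f : Lp ℝ ∞ ν) : ∀ᵐ ω ∂ν, (0 : POperator ν) f ω = 0 :=
  Lp.coeFn_zero ℝ 1 ν

theorem inv_le_volume_floor_eq {N j : ℕ} (hj : j < N) :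
    (N : ℝ≥0∞)⁻¹ ≤ volume {x : unitInterval | ⌊(x : ℝ) * N⌋₊ = j} := by
  have hN : (0 : ℝ) < N := by exact_mod_cast (Nat.zero_le j).trans_lt hj
  have hj' : (j : ℝ) + 1 ≤ N := by exact_mod_cast hj
  have ha : (j : ℝ) / N ∈ unitInterval :=
    ⟨by positivity, div_le_one_of_le₀ (by linarith) hN.le⟩
  have hb : ((j : ℝ) + 1) / N ∈ unitInterval :=
    ⟨by positivity, div_le_one_of_le₀ hj' hN.le⟩
  calc (N : ℝ≥0∞)⁻¹ = volume (Set.Ico (⟨_, ha⟩ : unitInterval) ⟨_, hb⟩) := by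
        rw [unitInterval.volume_Ico]
        simp only
        rw [← sub_div, add_sub_cancel_left, ENNReal.ofReal_div_of_pos hN]
        simp
    _ ≤ _ := by
        refine measure_mono fun x hx => ?_
        have h1 : (j : ℝ) / N ≤ x := hx.1
        have h2 : (x : ℝ) < (j + 1) / N := hx.2
        rw [div_le_iff₀ hN] at h1
        rw [lt_div_iff₀ hN] at h2
        exact (Nat.floor_eq_iff (mul_nonneg x.2.1 hN.le)).2 ⟨h1, h2⟩

/-- Joint laws of functions on the edgeless graph are joint laws of step functions on `[0, 1]`. -/
theorem exists_edist_jointLaw_bot_le_zero (n : ℕ) {k : ℕ}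
    (f : Fin k → Lp ℝ ∞ (uniformMeasure (Fin (n + 1)))) (hf : ∀ i, ‖f i‖ ≤ 1) :
    ∃ g : Fin k → Lp ℝ ∞ (volume : Measure unitInterval), (∀ i, ‖g i‖ ≤ 1) ∧
      edist (LevyProkhorov.ofMeasure (jointLaw (adjacencyOperator ⊥) f))
        (LevyProkhorov.ofMeasure (jointLaw 0 g)) ≤ 0 := by
  -- The default 0 is used only at `x = 1`, whose floor is `n + 1`.
  set F : Fin k → ℕ → ℝ := fun i j => if h : j < n + 1 then f i ⟨j, h⟩ else 0
  have hF : ∀ i j, |F i j| ≤ 1 := fun i j => by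
    by_cases h : j < n + 1
    · simp only [F, dif_pos h]
      exact (abs_apply_le_norm_of_uniformMeasure (f i) _).trans (hf i)
    · simp only [F, dif_neg h, abs_zero, zero_le_one]
  set p : unitInterval → ℕ := fun x => ⌊(x : ℝ) * (n + 1 : ℕ)⌋₊
  have hp : Measurable p := Nat.measurable_floor.comp (measurable_subtype_coe.mul_const _)
  have hmem : ∀ i, MemLp (fun x => F i (p x)) ∞ (volume : Measure unitInterval) := fun i =>
    MemLp.of_bound ((measurable_from_top (f := F i)).comp hp).aestronglyMeasurable 1
      (Eventually.of_forall fun x => hF i (p x))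
  refine ⟨fun i => (hmem i).toLp, fun i => norm_le_of_ae_abs_le _ zero_le_one ?_, ?_⟩
  · filter_upwards [(hmem i).coeFn_toLp] with x hx
    rw [hx]
    exact hF i _
  · refine levyProkhorov_edist_le fun ε B hε hε' hB => ?_
    rw [jointLaw_apply _ f hB, jointLaw_apply _ _ Metric.isOpen_thickening.measurableSet]
    refine le_add_right ?_
    set S := jointMap (adjacencyOperator (⊥ : SimpleGraph (Fin (n + 1)))) f ⁻¹' B
    have h1 : uniformMeasure (Fin (n + 1)) S ≤
        volume (⋃ j ∈ S.toFinite.toFinset, {x : unitInterval | p x = (j : ℕ)}) := by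
      rw [measure_biUnion_finset]
      · refine le_trans ?_ (Finset.card_nsmul_le_sum _ _ ((n + 1 : ℕ) : ℝ≥0∞)⁻¹
          fun j _ => inv_le_volume_floor_eq j.2)
        rw [uniformMeasure_apply, Set.ncard_eq_toFinset_card S, nsmul_eq_mul, Fintype.card_fin,
          div_eq_mul_inv]
      · intro i _ j _ hij
        refine Set.disjoint_left.2 fun x hx hx' => hij (Fin.ext ?_)
        exact (hx : p x = i).symm.trans hx'
      · exact fun j _ => hp (measurableSet_singleton _)
    refine h1.trans (measure_mono_ae ?_)
    filter_upwards [ae_all_iff.2 fun i => (hmem i).coeFn_toLp,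
      ae_all_iff.2 fun i => zero_pOperator_coeFn (hmem i).toLp] with x h2 h3 h4
    obtain ⟨j, hj, hjx⟩ := Set.mem_iUnion₂.1 h4
    rw [Set.Finite.mem_toFinset] at hj
    refine Metric.self_subset_thickening (ENNReal.toReal_pos hε.ne' hε'.ne) B ?_
    have h5 : jointMap (0 : POperator (volume : Measure unitInterval)) (fun i => (hmem i).toLp) x =
        jointMap (adjacencyOperator (⊥ : SimpleGraph (Fin (n + 1)))) f j := by
      ext (i | i)
      · rw [jointMap_inl, jointMap_inl, h2 i, (hjx : p x = j)]
        exact dif_pos j.2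
      · rw [jointMap_inr, jointMap_inr, h3 i, adjacencyOperator_bot_coeFn]
    rw [h5]
    exact hj

/-- Embed the disjoint union of blocks of sizes `c q` into `Fin N`, label each block by `q`, and
label leftover points arbitrarily. -/
theorem exists_le_ncard_fiber {Q : Type*} [Fintype Q] [Nonempty Q] (c : Q → ℕ) {N : ℕ}
    (h : ∑ q, c q ≤ N) : ∃ φ : Fin N → Q, ∀ q, c q ≤ (φ ⁻¹' {q}).ncard := by
  obtain ⟨e⟩ := Function.Embedding.nonempty_of_card_le (α := Σ q, Fin (c q)) (β := Fin N)
    (by simpa using h)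
  refine ⟨Function.extend e Sigma.fst fun _ => Classical.arbitrary Q, fun q => ?_⟩
  have h1 : Set.range (fun a : Fin (c q) => e ⟨q, a⟩) ⊆
      Function.extend e Sigma.fst (fun _ => Classical.arbitrary Q) ⁻¹' {q} := by
    rintro _ ⟨a, rfl⟩
    exact e.injective.extend_apply _ _ _
  refine le_trans (le_of_eq ?_) (Set.ncard_le_ncard h1 (Set.toFinite _))
  rw [← Set.image_univ, Set.ncard_image_of_injective _ fun a b hab => by
    simpa using e.injective hab]
  simp

/-- Functions in the unit ball, rounded to multiples of `1 / m`. -/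
theorem exists_measurable_rounding {Ω : Type*} {mΩ : MeasurableSpace Ω} {ν : Measure Ω} {k : ℕ}
    (g : Fin k → Lp ℝ ∞ ν) (hg : ∀ i, ‖g i‖ ≤ 1) {m : ℕ} (hm : 0 < m) :
    ∃ q : Ω → Fin k → Fin (2 * m + 1), Measurable q ∧
      ∀ᵐ ω ∂ν, ∀ i, |g i ω - ((q ω i : ℝ) - m) / m| ≤ 1 / m := by
  have hm' : (0 : ℝ) < m := by exact_mod_cast hm
  -- Floors in `[-m, m]` are shifted by `m`; the truncations by `toNat` and `min` act only on the
  -- null set where `|g i| > 1`.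
  set t : ℤ → Fin (2 * m + 1) := fun z => ⟨min (z + m).toNat (2 * m), by omega⟩ with ht
  refine ⟨fun ω i => t ⌊g i ω * m⌋, ?_, ?_⟩
  · exact measurable_pi_lambda _ fun i => (measurable_from_top (f := t)).comp
      (Int.measurable_floor.comp ((IsMeasureFilter.measurable_coe (g i)).mul_const _))
  · filter_upwards [ae_all_iff.2 fun i => IsMeasureFilter.ae_abs_le_norm (g i)] with ω hω i
    obtain ⟨h1, h2⟩ := abs_le.1 ((hω i).trans (hg i))
    have hlo : -(m : ℤ) ≤ ⌊g i ω * m⌋ := by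
      rw [Int.le_floor]
      push_cast
      nlinarith
    have hhi : ⌊g i ω * m⌋ ≤ (m : ℤ) := by
      rw [← Int.floor_natCast (R := ℝ) m]
      refine Int.floor_le_floor ?_
      nlinarith
    have h3 : ((t ⌊g i ω * m⌋ : ℕ) : ℤ) = ⌊g i ω * m⌋ + m := by
      simp only [ht]
      omega
    have h4 : ((t ⌊g i ω * m⌋ : ℕ) : ℝ) = ⌊g i ω * m⌋ + m := by exact_mod_cast h3
    have h5 := Int.floor_le (g i ω * m)
    have h6 := (Int.lt_floor_add_one (g i ω * m)).le
    rw [h4, add_sub_cancel_right, show g i ω - (⌊g i ω * m⌋ : ℝ) / m =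
      (g i ω * m - ⌊g i ω * m⌋) / m by field_simp, abs_div, abs_of_pos hm']
    gcongr
    rw [abs_le]
    constructor <;> linarith

/-- Joint laws of functions on a probability space are approximated by joint laws of functions on
edgeless graphs. -/
theorem exists_edist_jointLaw_zero_bot_le {Ω : Type*} {mΩ : MeasurableSpace Ω} {ν : Measure Ω}
    [IsProbabilityMeasure ν] (n : ℕ) {k : ℕ} (g : Fin k → Lp ℝ ∞ ν) (hg : ∀ i, ‖g i‖ ≤ 1)
    {m : ℕ} (hm : 0 < m) :
    ∃ f : Fin k → Lp ℝ ∞ (uniformMeasure (Fin (n + 1))), (∀ i, ‖f i‖ ≤ 1) ∧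
      edist (LevyProkhorov.ofMeasure (jointLaw 0 g))
        (LevyProkhorov.ofMeasure (jointLaw (adjacencyOperator ⊥) f)) ≤
        max (ENNReal.ofReal ((k + k : ℕ) * (1 / m)))
          ((((2 * m + 1) ^ k : ℕ) : ℝ≥0∞) / (n + 1 : ℕ)) := by
  have hm' : (0 : ℝ) < m := by exact_mod_cast hm
  obtain ⟨q, hq, hqg⟩ := exists_measurable_rounding g hg hm
  set N := n + 1
  have hN : (0 : ℝ) < N := by positivity
  -- Vertex quotas for the rounding cells. Each floor loses less than one vertex, so all `(2m+1)^k`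
  -- cells together lose mass at most `(2m+1)^k / N`.
  set c : (Fin k → Fin (2 * m + 1)) → ℕ := fun s => ⌊ν.real (q ⁻¹' {s}) * N⌋₊
  have hc : ∑ s, c s ≤ N := by
    have h1 : ∑ s, ν.real (q ⁻¹' {s}) = 1 := by
      rw [← measureReal_biUnion_finset]
      · rw [show (⋃ s ∈ (Finset.univ : Finset (Fin k → Fin (2 * m + 1))), q ⁻¹' {s}) = Set.univ by
          ext; simp]
        simp
      · exact fun s _ t _ hst => Set.disjoint_left.2 fun x hx hx' => hst
          ((hx : q x = s).symm.trans hx')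
      · exact fun s _ => hq (measurableSet_singleton _)
    have h2 : ((∑ s, c s : ℕ) : ℝ) ≤ N := by
      push_cast
      calc ∑ s, (c s : ℝ) ≤ ∑ s, ν.real (q ⁻¹' {s}) * N :=
            Finset.sum_le_sum fun s _ => Nat.floor_le (by positivity)
        _ = N := by rw [← Finset.sum_mul, h1, one_mul]
    exact_mod_cast h2
  obtain ⟨φ, hφ⟩ := exists_le_ncard_fiber c hc
  refine ⟨fun i => uniformToLp fun x => ((φ x i : ℝ) - m) / m, fun i =>
    norm_uniformToLp_le fun x => ?_, ?_⟩
  · rw [abs_div, abs_of_pos hm']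
    refine div_le_one_of_le₀ ?_ hm'.le
    have h1 : ((φ x i : ℕ) : ℝ) ≤ 2 * m := by exact_mod_cast Nat.lt_succ_iff.1 (φ x i).2
    have h2 : (0 : ℝ) ≤ (φ x i : ℕ) := by positivity
    rw [abs_le]
    constructor <;> linarith
  · refine levyProkhorov_edist_le fun ε B hε hε' hB => ?_
    rw [jointLaw_apply _ g hB, jointLaw_apply _ _ Metric.isOpen_thickening.measurableSet]
    set f : Fin k → Lp ℝ ∞ (uniformMeasure (Fin N)) :=
      fun i => uniformToLp fun x => ((φ x i : ℝ) - m) / m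
    classical
    -- The grid values lying near a point of `B` with zero image coordinates: almost all of the
    -- preimage of `B` falls in their cells, and vertices with these labels land in the thickening.
    set T : Finset (Fin k → Fin (2 * m + 1)) := Finset.univ.filter fun s =>
      ∃ y ∈ B, (∀ i, |y (Sum.inl i) - ((s i : ℝ) - m) / m| ≤ 1 / m) ∧ ∀ i, y (Sum.inr i) = 0
      with hT
    have h1 : ν (jointMap 0 g ⁻¹' B) ≤ ν (⋃ s ∈ T, q ⁻¹' {s}) := by
      refine measure_mono_ae ?_
      filter_upwards [hqg, ae_all_iff.2 fun i => zero_pOperator_coeFn (g i)] with ω h2 h3 h4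
      refine Set.mem_iUnion₂.2 ⟨q ω, Finset.mem_filter.2 ⟨Finset.mem_univ _, _, h4, h2, h3⟩, rfl⟩
    have h2 : ∀ s, ν (q ⁻¹' {s}) ≤ ((φ ⁻¹' {s}).ncard + 1 : ℕ) / (N : ℝ≥0∞) := by
      intro s
      rw [ENNReal.le_div_iff_mul_le (by simp) (by simp), ← ofReal_measureReal,
        ← ENNReal.ofReal_natCast, ← ENNReal.ofReal_mul (by positivity), ← ENNReal.ofReal_natCast]
      refine ENNReal.ofReal_le_ofReal ((Nat.lt_floor_add_one _).le.trans ?_)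
      exact_mod_cast Nat.succ_le_succ (hφ s)
    have h3 : ∑ s ∈ T, (φ ⁻¹' {s}).ncard = (φ ⁻¹' (T : Set (Fin k → Fin (2 * m + 1)))).ncard := by
      have := Finset.card_eq_sum_card_fiberwise (f := φ) (s := Finset.univ.filter fun x => φ x ∈ T)
        (t := T) (fun x hx => by simpa using hx)
      rw [show φ ⁻¹' (T : Set (Fin k → Fin (2 * m + 1))) =
        ((Finset.univ.filter fun x => φ x ∈ T : Finset (Fin N)) : Set (Fin N)) by ext; simp,
        Set.ncard_coe_finset, this]
      refine Finset.sum_congr rfl fun s hs => ?_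
      rw [← Set.ncard_coe_finset]
      congr 1
      ext x
      simp only [Set.mem_preimage, Set.mem_singleton_iff, Finset.coe_filter, Finset.mem_filter,
        Finset.mem_univ, true_and, Set.mem_ofPred_eq]
      exact ⟨fun h => ⟨h ▸ hs, h⟩, fun h => h.2⟩
    have h4 : ν (⋃ s ∈ T, q ⁻¹' {s}) ≤
        uniformMeasure (Fin N) (φ ⁻¹' (T : Set (Fin k → Fin (2 * m + 1)))) +
          (((2 * m + 1) ^ k : ℕ) : ℝ≥0∞) / (N : ℕ) := by
      refine (measure_biUnion_finset_le _ _).trans ((Finset.sum_le_sum fun s _ => h2 s).trans ?_)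
      rw [uniformMeasure_apply, ← h3, Fintype.card_fin, ← ENNReal.add_div]
      simp only [div_eq_mul_inv]
      rw [← Finset.sum_mul]
      gcongr
      have h5 : T.card ≤ (2 * m + 1) ^ k := (Finset.card_le_univ T).trans_eq (by simp)
      have h6 : ∑ s ∈ T, ((φ ⁻¹' {s}).ncard + 1) ≤
          ∑ s ∈ T, (φ ⁻¹' {s}).ncard + (2 * m + 1) ^ k := by
        rw [Finset.sum_add_distrib]
        simpa using h5
      exact_mod_cast h6
    refine h1.trans (h4.trans (add_le_add (measure_mono fun x hx => ?_)
      ((le_max_right _ _).trans hε.le)))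
    obtain ⟨-, y, hy, hy1, hy2⟩ := Finset.mem_filter.1 (show φ x ∈ T from hx)
    refine Metric.mem_thickening_iff.2 ⟨y, hy, ?_⟩
    rw [dist_comm]
    refine (dist_euclidean_le (r := 1 / m) _ _ (by positivity) ?_).trans_lt ?_
    · rintro (i | i)
      · rw [jointMap_inl, uniformToLp_coeFn]
        exact hy1 i
      · rw [jointMap_inr, adjacencyOperator_bot_coeFn, hy2, sub_self, abs_zero]
        positivity
    · rw [Fintype.card_sum, Fintype.card_fin]
      exact (ENNReal.ofReal_lt_iff_lt_toReal (by positivity) hε'.ne).1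
        ((le_max_left _ _).trans_lt hε)

/-- The edgeless graphs action converge to the zero operator on `[0, 1]`. -/
theorem actionConverges_bot :
    ActionConverges (fun n => adjacencyOperator (⊥ : SimpleGraph (Fin (n + 1))))
      (0 : POperator (volume : Measure unitInterval)) := by
  refine actionConverges_of_tendsto_hausdorffEDist fun k => ?_
  rw [ENNReal.tendsto_nhds_zero]
  intro ε hε
  -- The mesh is fixed before `n`, since the number of cells grows with `m`.
  obtain ⟨m, hm0, hm⟩ : ∃ m : ℕ, 0 < m ∧ ENNReal.ofReal ((k + k : ℕ) * (1 / m)) ≤ ε := by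
    have h1 : Tendsto (fun m : ℕ => ENNReal.ofReal ((k + k : ℕ) * (1 / (m : ℝ)))) atTop (𝓝 0) := by
      have := ENNReal.tendsto_ofReal
        ((tendsto_one_div_atTop_nhds_zero_nat (𝕜 := ℝ)).const_mul ((k + k : ℕ) : ℝ))
      simpa using this
    exact ((eventually_gt_atTop 0).and (h1.eventually_le_const hε)).exists
  have h2 : Tendsto (fun n : ℕ => (((2 * m + 1) ^ k : ℕ) : ℝ≥0∞) / (n + 1 : ℕ)) atTop (𝓝 0) := by
    have h3 := (ENNReal.tendsto_inv_nat_nhds_zero.comp (tendsto_add_atTop_nat 1))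
    have h4 := ENNReal.Tendsto.const_mul (a := (((2 * m + 1) ^ k : ℕ) : ℝ≥0∞)) h3
      (Or.inr (ENNReal.natCast_ne_top _))
    rw [mul_zero] at h4
    simpa only [div_eq_mul_inv, Function.comp_def] using h4
  filter_upwards [h2.eventually_le_const hε] with n hn
  refine Metric.hausdorffEDist_le_of_mem_edist ?_ ?_
  · rintro _ ⟨f, hf, rfl⟩
    obtain ⟨g, hg, hfg⟩ := exists_edist_jointLaw_bot_le_zero n f hf
    exact ⟨_, jointLaw_mem_kProfile _ hg, hfg.trans bot_le⟩
  · rintro _ ⟨g, hg, rfl⟩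
    obtain ⟨f, hf, hgf⟩ := exists_edist_jointLaw_zero_bot_le n g hg hm0
    exact ⟨_, jointLaw_mem_kProfile _ hf, hgf.trans (max_le hm hn)⟩

end edgeless

/-! ### Assembly of the theorem. -/

/-- The conclusions about `A⁺` and `A⁻` for a convergent sequence of graphs. -/
theorem exists_isMeasureFilter_actionConverges {V : ℕ → Type*} [∀ n, Fintype (V n)]
    [∀ n, Nonempty (V n)] {G : ∀ n, SimpleGraph (V n)} {Ω : Type*} {m : MeasurableSpace Ω}
    {ν : Measure Ω} [IsProbabilityMeasure ν] {A : POperator ν}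
    (hV : Tendsto (fun n => Fintype.card (V n)) atTop atTop)
    (hA : ActionConverges (fun n => adjacencyOperator (G n)) A) :
    ∃ F : Set (Set Ω), IsMeasureFilter ν F ∧
      ∀ (U : Set (Set Ω)) (hU : Maximal (IsMeasureFilter ν) U), F ⊆ U →
        ActionConverges (fun n => adjacencyOperator (G n).addUniversalVertex)
          (plusOperator A hU) ∧
        ActionConverges (fun n => adjacencyOperator (G n).addUniversalVertex)
          (minusOperator A hU) := by
  obtain ⟨F, hF, hsmall⟩ := exists_isMeasureFilter_norm_map_le A
    fun δ hδ => hA.exists_cover_measure_le hV hδ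
  refine ⟨F, hF, fun U hU hFU => actionConverges_addUniversalVertex hV hA hU fun δ hδ => ?_⟩
  obtain ⟨S, hS, h⟩ := hsmall δ hδ
  exact ⟨S, hFU hS, h⟩

theorem theorem1p4 :
    -- the general statement
    (∀ (V : ℕ → Type*) [∀ n, Fintype (V n)] [∀ n, Nonempty (V n)] (G : ∀ n, SimpleGraph (V n))
        (Ω : Type*) [MeasurableSpace Ω] (ν : Measure Ω) [IsProbabilityMeasure ν] [IsSeparable ν]
        (A : POperator ν),
        Tendsto (fun n => Fintype.card (V n)) atTop atTop →
        ActionConverges (fun n => adjacencyOperator (G n)) A →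
        (∃ F : Set (Set Ω), IsMeasureFilter ν F ∧
          ∀ (U : Set (Set Ω)) (hU : Maximal (IsMeasureFilter ν) U), F ⊆ U →
            ActionConverges (fun n => adjacencyOperator (G n).addUniversalVertex)
              (plusOperator A hU) ∧
            ActionConverges (fun n => adjacencyOperator (G n).addUniversalVertex)
              (minusOperator A hU) ∧
            plusOperator A hU ≠ minusOperator A hU ∧
            WeaklyEquivalent (plusOperator A hU) (minusOperator A hU) ∧
            ¬ IsSelfAdjointOp (plusOperator A hU) ∧
            ¬ IsSelfAdjointOp (minusOperator A hU) ∧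
            ∀ c : ℝ, IsRegularOp c A →
              IsRegularOp (c + 1) (plusOperator A hU) ∧
              IsRegularOp (c - 1) (minusOperator A hU)) ∧
        -- no action limit whatsoever is self-adjoint
        (∀ (Ω' : Type*) [MeasurableSpace Ω'] (ν' : Measure Ω') [IsProbabilityMeasure ν']
          (B : POperator ν'),
          ActionConverges (fun n => adjacencyOperator (G n).addUniversalVertex) B →
            ¬ IsSelfAdjointOp B)) ∧
    -- the stars, arising from the edgeless graphs, whose action limit is the zero operator
    (ActionConverges (fun n => adjacencyOperator (⊥ : SimpleGraph (Fin (n + 1))))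
        (0 : POperator (volume : Measure unitInterval)) ∧
      ∃ (U : Set (Set unitInterval))
        (hU : Maximal (IsMeasureFilter (volume : Measure unitInterval)) U),
        ActionConverges
          (fun n => adjacencyOperator (⊥ : SimpleGraph (Fin (n + 1))).addUniversalVertex)
          (plusOperator 0 hU) ∧
        ActionConverges
          (fun n => adjacencyOperator (⊥ : SimpleGraph (Fin (n + 1))).addUniversalVertex)
          (minusOperator 0 hU) ∧
        WeaklyEquivalent (plusOperator 0 hU) (minusOperator 0 hU) ∧
        IsPositivityPreserving (plusOperator 0 hU) ∧
        ¬ IsPositivityPreserving (minusOperator 0 hU) ∧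
        IsRegularOp 1 (plusOperator 0 hU) ∧
        ¬ IsRegularOp 1 (minusOperator 0 hU)) := by
  refine ⟨fun V _ _ G Ω _ ν _ _ A hV hA => ⟨?_, ?_⟩, actionConverges_bot, ?_⟩
  · obtain ⟨F, hF, h⟩ := exists_isMeasureFilter_actionConverges hV hA
    refine ⟨F, hF, fun U hU hFU => ?_⟩
    obtain ⟨hplus, hminus⟩ := h U hU hFU
    exact ⟨hplus, hminus, plusOperator_ne_minusOperator A hU, hplus.weaklyEquivalent hminus,
      hplus.not_isSelfAdjointOp hV, hminus.not_isSelfAdjointOp hV,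
      fun c hc => ⟨hc.plusOperator hU, hc.minusOperator hU⟩⟩
  · exact fun Ω' _ ν' _ B hB => hB.not_isSelfAdjointOp hV
  · have hV : Tendsto (fun n => Fintype.card (Fin (n + 1))) atTop atTop := by
      simpa using tendsto_add_atTop_nat 1
    obtain ⟨F, hF, h⟩ := exists_isMeasureFilter_actionConverges hV actionConverges_bot
    obtain ⟨U, hFU, hU⟩ := exists_isMeasureFilter_maximal hF
    obtain ⟨hplus, hminus⟩ := h U hU hFU
    refine ⟨U, hU, hplus, hminus, hplus.weaklyEquivalent hminus,
      isPositivityPreserving_plusOperator_zero hU,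
      not_isPositivityPreserving_minusOperator_zero hU, ?_, fun h1 => ?_⟩
    · simpa using isRegularOp_zero.plusOperator hU
    -- The regularity constant is unique, and here it is `-1`.
    · have := h1.eq (isRegularOp_zero.minusOperator hU)
      norm_num at this
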